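/- Let $X$ be a CAT(0) space. An isometry $r$ of $X$ is a \emph{reflection} if $r^2=1$, its fixed-point set $F_r$ has empty interior, and $X\setminus F_r$ has exactly two connected components, which are both convex and are interchanged by $r$. Let $W$ be a \emph{cocompact discrete reflection group} of $X$: a group of isometries of $X$ that is generated by reflections of $X$, that acts properly (for all $x\in X$ and $N>0$ the set $\{g\in W : gx\in B(x,N)\}$ is finite), and for which a chamber $C$ has compact closure and trivial stabilizer $\{g\in W : gC=C\}=\{1\}$; here $R$ denotes the set of all reflections of $X$ that lie in $W$, and a \emph{chamber} is a connected component of $X\setminus\bigcup_{r\in R}F_r$. Fix a chamber $C$ containing a base point $x_0$, write $X_r^+$ for the component of $X\setminus F_r$ containing $x_0$, and let $S\subset R$ be minimal with $C=\bigcap_{s\in S}X_s^+$, that is, $C\neq\bigcap_{s\in S\setminus\{s'\}}X_s^+$ for every $s'\in S$. Call $T\subset S$ \emph{spherical} if the subgroup of $W$ generated by $T$ is finite, and let $o(g)\in\mathbb{N}\cup\{\infty\}$ denote the order of $g\in W$. Let $\partial X$ be the boundary of $X$ (the asymptote classes of geodesic rays) with the cone topology, and for $w\in W$ of infinite order let $w^\infty\in\partial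 X$ be the limit of $w^n x$ in $X\cup\partial X$ as $n\to\infty$, for any $x\in X$. Suppose that there exist a maximal spherical subset $T$ of $S$ and an element $s_0\in S$ such that $o(s_0t)\ge 3$ for every $t\in T$ and $o(s_0t_0)=\infty$ for some $t_0\in T$. Then (1) there is $\alpha\in\partial X$ whose orbit $W\alpha$ is dense in $\partial X$; and (2) the set $\{w^\infty : w\in W,\ o(w)=\infty\}$ is dense in $\partial X$. -/

import Mathlib

open Set Filter Topology
open scoped NNReal

section CATZero

variable {X : Type*} [MetricSpace X]

/-- `c` restricted to `[0, dist x y]` is a geodesic path from `x` to `y`. -/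
def IsGeodesic (c : ℝ → X) (x y : X) : Prop :=
  c 0 = x ∧ c (dist x y) = y ∧
    ∀ s ∈ Icc 0 (dist x y), ∀ t ∈ Icc 0 (dist x y), dist (c s) (c t) = |s - t|

variable (X) in
/-- Geodesic metric spaces: any two points are joined by a geodesic. -/
def IsGeodesicSpace : Prop := ∀ x y : X, ∃ c : ℝ → X, IsGeodesic c x y

variable (X) in
/-- `X` is a CAT(0) space: it is geodesic, and every geodesic triangle is at least as thin as its
comparison triangle in the Euclidean plane. Two sides of a triangle always share a vertex, here
called `p`; the points `x'` and `y'` are the comparison points of `c s` and `c' t`. -/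
def IsCATZero : Prop :=
  IsGeodesicSpace X ∧
    ∀ (p q r : X) (c c' : ℝ → X), IsGeodesic c p q → IsGeodesic c' p r →
      ∀ s ∈ Icc 0 (dist p q), ∀ t ∈ Icc 0 (dist p r),
        ∀ p' q' r' x' y' : EuclideanSpace ℝ (Fin 2),
          dist p' q' = dist p q → dist p' r' = dist p r → dist q' r' = dist q r →
          dist p' x' = s → dist x' q' = dist p q - s →
          dist p' y' = t → dist y' r' = dist p r - t →
          dist (c s) (c' t) ≤ dist x' y'

/-- A subset of a geodesic space is convex if it contains every geodesic joining two of its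
points. -/
def IsGeodesicallyConvex (A : Set X) : Prop :=
  ∀ x ∈ A, ∀ y ∈ A, ∀ c : ℝ → X, IsGeodesic c x y → ∀ t ∈ Icc 0 (dist x y), c t ∈ A

end CATZero

section Boundary

/-- Geodesic rays `[0, ∞) → X`. -/
structure GeodesicRay (X : Type*) [MetricSpace X] where
  toFun : ℝ≥0 → X
  isometry : Isometry toFun

/-- Two geodesic rays are asymptotic if they stay at bounded distance. -/
instance GeodesicRay.asymptotic (X : Type*) [MetricSpace X] : Setoid (GeodesicRay X) where
  r c c' := ∃ K : ℝ, ∀ t, dist (c.toFun t) (c'.toFun t) ≤ K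
  iseqv :=
    { refl := fun _ => ⟨0, fun _ => by simp⟩
      symm := fun ⟨K, h⟩ => ⟨K, fun t => by rw [dist_comm]; exact h t⟩
      trans := fun ⟨K, h⟩ ⟨K', h'⟩ =>
        ⟨K + K', fun t => (dist_triangle _ _ _).trans (add_le_add (h t) (h' t))⟩ }

/-- The boundary `∂X`: asymptote classes of geodesic rays. -/
def VisualBoundary (X : Type*) [MetricSpace X] : Type _ :=
  Quotient (GeodesicRay.asymptotic X)

variable {X : Type*} [MetricSpace X]

/-- The endpoint `c(∞) ∈ ∂X` of a geodesic ray. -/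
def GeodesicRay.endpoint (c : GeodesicRay X) : VisualBoundary X :=
  Quotient.mk (GeodesicRay.asymptotic X) c

/-- The image of a geodesic ray under an isometry. -/
def GeodesicRay.map (g : X ≃ᵢ X) (c : GeodesicRay X) : GeodesicRay X where
  toFun t := g (c.toFun t)
  isometry := g.isometry.comp c.isometry

/-- The action of an isometry on `∂X`: the endpoint of `c` goes to the endpoint of `g ∘ c`. -/
def VisualBoundary.map (g : X ≃ᵢ X) : VisualBoundary X → VisualBoundary X :=
  Quotient.map (GeodesicRay.map g) fun _ _ ⟨K, h⟩ =>
    ⟨K, fun t => (g.dist_eq _ _).trans_le (h t)⟩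

/-- The bordification `X ∪ ∂X`. -/
inductive Bordification (X : Type*) [MetricSpace X] where
  | point (x : X) : Bordification X
  | ideal (ξ : VisualBoundary X) : Bordification X

/-- For a geodesic ray `c` issuing from `b = c 0`, the set `U(c, r, ε)` of all `z ∈ X ∪ ∂X` with
`d(b, z) > r` such that the geodesic (or geodesic ray) from `b` to `z` passes at time `r` within
`ε` of `c r`. -/
def coneNhd (c : GeodesicRay X) (r : ℝ≥0) (ε : ℝ) : Set (Bordification X) :=
  {z | match z with
    | .point x => (r : ℝ) < dist (c.toFun 0) x ∧
        ∃ γ : ℝ → X, IsGeodesic γ (c.toFun 0) x ∧ dist (γ r) (c.toFun r) < ε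
    | .ideal ξ => ∃ c' : GeodesicRay X, c'.toFun 0 = c.toFun 0 ∧ c'.endpoint = ξ ∧
        dist (c'.toFun r) (c.toFun r) < ε}

/-- The cone topology on `X ∪ ∂X` with base point `b`: it is generated by the open subsets of `X`
and the sets `U(c, r, ε)` for the geodesic rays `c` issuing from `b`. -/
abbrev coneTopology (b : X) : TopologicalSpace (Bordification X) :=
  TopologicalSpace.generateFrom
    ({V | ∃ O : Set X, IsOpen O ∧ V = Bordification.point '' O} ∪
     {V | ∃ (c : GeodesicRay X) (r : ℝ≥0) (ε : ℝ),
        c.toFun 0 = b ∧ 0 < r ∧ 0 < ε ∧ V = coneNhd c r ε})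

/-- The cone topology on `∂X` with base point `b`: the subspace topology from `X ∪ ∂X`. -/
abbrev boundaryTopology (b : X) : TopologicalSpace (VisualBoundary X) :=
  (coneTopology b).induced Bordification.ideal

/-- `ξ = w^∞`, that is, the sequence `w ^ n x` converges to `ξ` in `X ∪ ∂X` for every `x ∈ X`
(with respect to the cone topology for every base point). -/
def IsInfinitePower (w : X ≃ᵢ X) (ξ : VisualBoundary X) : Prop :=
  ∀ b x : X, Tendsto (fun n : ℕ => Bordification.point ((w ^ n) x)) atTop
    (@nhds _ (coneTopology b) (Bordification.ideal ξ))

end Boundary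

section Reflections

variable {X : Type*} [MetricSpace X]

/-- The set of connected components of a subset. -/
def componentsIn (U : Set X) : Set (Set X) := {A | ∃ x ∈ U, A = connectedComponentIn U x}

/-- The fixed-point set `F_r`, which is the wall of `r` if `r` is a reflection. -/
def wall (r : X ≃ᵢ X) : Set X := {x | r x = x}

/-- `r` is a reflection of the geodesic space `X`: an involutive isometry whose fixed-point set has
empty interior and whose complement has exactly two components, which are convex and are
interchanged by `r`. -/
def IsReflection (r : X ≃ᵢ X) : Prop :=
  r ^ 2 = 1 ∧ interior (wall r) = ∅ ∧
    ∃ A B : Set X, A ≠ B ∧ componentsIn (wall r)ᶜ = {A, B} ∧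
      IsGeodesicallyConvex A ∧ IsGeodesicallyConvex B ∧ r '' A = B ∧ r '' B = A

/-- The component of `X \ F_r` that contains `x`. -/
def halfSpace (x : X) (r : X ≃ᵢ X) : Set X := connectedComponentIn (wall r)ᶜ x

/-- The set of all reflections of `X` in `W`. -/
def reflectionsIn (W : Subgroup (X ≃ᵢ X)) : Set (X ≃ᵢ X) := {r | r ∈ W ∧ IsReflection r}

/-- An isometry group generated by some set of reflections. -/
def IsReflectionGroup (W : Subgroup (X ≃ᵢ X)) : Prop :=
  ∃ A : Set (X ≃ᵢ X), (∀ r ∈ A, IsReflection r) ∧ Subgroup.closure A = W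

/-- The action of `W` on `X` is proper. -/
def ActsProperly (W : Subgroup (X ≃ᵢ X)) : Prop :=
  ∀ (x : X) (N : ℝ), 0 < N → {g : X ≃ᵢ X | g ∈ W ∧ g x ∈ Metric.ball x N}.Finite

/-- A chamber is a component of the complement of the union of all walls of reflections in `W`. -/
def IsChamber (W : Subgroup (X ≃ᵢ X)) (C : Set X) : Prop :=
  C ∈ componentsIn (⋃ r ∈ reflectionsIn W, wall r)ᶜ

/-- A cocompact discrete reflection group of `X`: a reflection group acting properly, for which a
chamber has compact closure and trivial stabilizer. (All chambers are `W`-translates of each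
other.) -/
def IsCocompactDiscreteReflectionGroup (W : Subgroup (X ≃ᵢ X)) : Prop :=
  IsReflectionGroup W ∧ ActsProperly W ∧
    ∃ C : Set X, IsChamber W C ∧ IsCompact (closure C) ∧ ∀ g ∈ W, g '' C = C → g = 1

/-- `S` is a minimal set of reflections in `W` with `C = ⋂ s ∈ S, X_s^+`, where `X_s^+` is the
component of `X \ F_s` that contains the base point `x₀`. -/
def IsMinimalDefiningSet (W : Subgroup (X ≃ᵢ X)) (x₀ : X) (C : Set X) (S : Set (X ≃ᵢ X)) :
    Prop :=
  S ⊆ reflectionsIn W ∧ C = ⋂ s ∈ S, halfSpace x₀ s ∧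
    ∀ s₀ ∈ S, C ≠ ⋂ s ∈ S \ {s₀}, halfSpace x₀ s

/-- `T` is a spherical subset of `S`: the subgroup `W_T` generated by `T` is finite. -/
def IsSphericalSubset (S T : Set (X ≃ᵢ X)) : Prop :=
  T ⊆ S ∧ (Subgroup.closure T : Set (X ≃ᵢ X)).Finite

end Reflections

/-! ### Geodesics and thin triangles in CAT(0) spaces -/

section CATZeroBasics

/-! Call `s ∈ S` a descent of `v ∈ W` if the wall of `s` separates `x₀` from `v x₀`. As `s₀ t₀` has
infinite order and the action is proper, the walls of `s₀` and `t₀` are disjoint, and hence their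
positive half-spaces cover `X` (`mem_halfSpace_or`). By cocompactness `g = t₀ s₀` attains its
minimal displacement (`exists_forall_dist_le`), which is positive, so `g` translates a ray; let `α =
g^∞` be its endpoint.

Geometric half (`exists_dist_ray_le`): suppose that `s₀` is the only descent of `w⁻¹`. For `n ≥ 1`
the geodesic from `w⁻¹ x₀` to `g ^ n x₀` starts on the negative side of `s₀`, ends on the negative
side of `t₀`, and stays on the positive side of every other wall of `S`; connectedness forces it
through `C`. After translation by `w`, for large `n`, the ray from `x₀` to `w α` passes within
bounded distance of `w x₀`.

Combinatorial half (`exists_dist_le_separates`): every orbit point `k x₀` is boundedly close to some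
`w x₀` with `w` as above. Multiplying `k⁻¹` by an element of the finite group `W_T` gives `v` with
all of `T` among its descents. Descents of one element generate a finite group, so by maximality `T`
is the whole descent set. Put `w = (s₀ v)⁻¹`. A descent `s ≠ s₀` of `s₀ v` is a descent of `v`, so
lies in `T`, and it is not `t₀` since the negative sides of `s₀` and `t₀` are disjoint. As `s` and
`s₀` do not commute, `s₀` is a descent of `s v`; so is `t₀`, a contradiction.

The orbit of `x₀` is coarsely dense, so any ray is approximated by rays towards points `w α`, which
is (1); and `w α = (w g w⁻¹)^∞` gives (2).

The Coxeter theory is derived from the geometry: folding along walls shortens distances, so nearest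
orbit points show that `S` generates `W`; only the wall of `t` separates `C` from `t C`, which
yields the exchange condition. -/

lemma exists_comparison_triangle {a b c : ℝ} (ha : 0 ≤ a) (hb : 0 ≤ b) (hc : 0 ≤ c)
    (h₁ : a ≤ b + c) (h₂ : b ≤ a + c) (h₃ : c ≤ a + b) :
    ∃ q r : EuclideanSpace ℝ (Fin 2), ‖q‖ = a ∧ ‖r‖ = b ∧ dist q r = c := by
  rcases ha.eq_or_lt with rfl | ha'
  · have hbc : b = c := by linarith
    subst hbc
    refine ⟨0, EuclideanSpace.single 0 b, by simp, by simp [abs_of_nonneg hb], ?_⟩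
    simp [abs_of_nonneg hb]
  -- Law of cosines, with `q` on the first axis; the bound on `x ^ 2` is Heron's inequality.
  · set x := (a ^ 2 + b ^ 2 - c ^ 2) / (2 * a) with hx
    have hxa : 2 * a * x = a ^ 2 + b ^ 2 - c ^ 2 := by rw [hx]; field_simp
    have hxb : x ^ 2 ≤ b ^ 2 := by
      have h : (2 * a) ^ 2 * x ^ 2 ≤ (2 * a) ^ 2 * b ^ 2 := by
        have e : (2 * a) ^ 2 * x ^ 2 = (a ^ 2 + b ^ 2 - c ^ 2) ^ 2 := by rw [← hxa]; ring
        rw [e]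
        have : 0 ≤ (c ^ 2 - (a - b) ^ 2) * ((a + b) ^ 2 - c ^ 2) := by
          apply mul_nonneg
          · nlinarith
          · nlinarith
        nlinarith
      exact le_of_mul_le_mul_left h (by positivity)
    have hy : 0 ≤ b ^ 2 - x ^ 2 := by linarith
    refine ⟨!₂[a, 0], !₂[x, √(b ^ 2 - x ^ 2)], ?_, ?_, ?_⟩
    · simp [EuclideanSpace.norm_eq, Real.sqrt_sq ha]
    · simp [EuclideanSpace.norm_eq, Real.sq_sqrt hy, Real.sqrt_sq hb]
    · simp only [EuclideanSpace.dist_eq, Fin.sum_univ_two, Real.dist_eq, sq_abs]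
      simp only [Matrix.cons_val_zero, Matrix.cons_val_one]
      rw [show (a - x) ^ 2 + (0 - √(b ^ 2 - x ^ 2)) ^ 2 = c ^ 2 by
        rw [zero_sub, neg_sq, Real.sq_sqrt hy]; linarith [hxa, sq (a - x)], Real.sqrt_sq hc]

variable {X : Type*} [MetricSpace X]

lemma IsGeodesic.dist_left {c : ℝ → X} {x y : X} (h : IsGeodesic c x y) {t : ℝ}
    (ht : t ∈ Icc 0 (dist x y)) : dist x (c t) = t := by
  have := h.2.2 0 ⟨le_rfl, dist_nonneg⟩ t ht
  rwa [h.1, zero_sub, abs_neg, abs_of_nonneg ht.1] at this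

lemma IsGeodesic.dist_right {c : ℝ → X} {x y : X} (h : IsGeodesic c x y) {t : ℝ}
    (ht : t ∈ Icc 0 (dist x y)) : dist (c t) y = dist x y - t := by
  have := h.2.2 t ht (dist x y) ⟨dist_nonneg, le_rfl⟩
  rwa [h.2.1, abs_sub_comm, abs_of_nonneg (by linarith [ht.2])] at this

lemma IsGeodesic.reverse {c : ℝ → X} {x y : X} (h : IsGeodesic c x y) :
    IsGeodesic (fun t => c (dist x y - t)) y x := by
  refine ⟨by simpa using h.2.1, by simpa [dist_comm y x] using h.1, fun s hs t ht => ?_⟩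
  rw [dist_comm y x] at hs ht
  rw [h.2.2 _ ⟨by linarith [hs.2], by linarith [hs.1]⟩ _ ⟨by linarith [ht.2], by linarith [ht.1]⟩,
    abs_sub_comm]
  congr 1; ring

lemma IsGeodesic.map {c : ℝ → X} {x y : X} (h : IsGeodesic c x y) (g : X ≃ᵢ X) :
    IsGeodesic (fun t => g (c t)) (g x) (g y) := by
  refine ⟨by simp only [h.1], by simp only [g.dist_eq, h.2.1], fun s hs t ht => ?_⟩
  rw [g.dist_eq] at hs ht ⊢
  exact h.2.2 s hs t ht

lemma IsGeodesic.initial {c : ℝ → X} {x y : X} (h : IsGeodesic c x y) {m : ℝ}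
    (hm : m ∈ Icc 0 (dist x y)) : IsGeodesic c x (c m) := by
  refine ⟨h.1, by rw [h.dist_left hm], fun s hs t ht => ?_⟩
  rw [h.dist_left hm] at hs ht
  exact h.2.2 s ⟨hs.1, hs.2.trans hm.2⟩ t ⟨ht.1, ht.2.trans hm.2⟩

lemma IsGeodesic.continuousOn {c : ℝ → X} {x y : X} (h : IsGeodesic c x y) :
    ContinuousOn c (Icc 0 (dist x y)) := by
  have : LipschitzOnWith 1 c (Icc 0 (dist x y)) :=
    LipschitzOnWith.of_dist_le_mul fun s hs t ht => by
      rw [h.2.2 s hs t ht, NNReal.coe_one, one_mul, Real.dist_eq]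
  exact this.continuousOn

/-- Distances between points of two geodesics with a common origin shrink towards the origin. -/
lemma IsCATZero.dist_le_mul (hX : IsCATZero X) {p q r : X} {c c' : ℝ → X}
    (hc : IsGeodesic c p q) (hc' : IsGeodesic c' p r) {l : ℝ} (hl : l ∈ Icc (0 : ℝ) 1) :
    dist (c (l * dist p q)) (c' (l * dist p r)) ≤ l * dist q r := by
  obtain ⟨q', r', hq, hr, hqr⟩ := exists_comparison_triangle (a := dist p q) (b := dist p r)
    (c := dist q r) dist_nonneg dist_nonneg dist_nonneg
    (by linarith [dist_triangle p r q, dist_comm r q]) (dist_triangle _ _ _)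
    (by linarith [dist_triangle q p r, dist_comm q p])
  have key : ∀ v : EuclideanSpace ℝ (Fin 2), dist 0 (l • v) = l * ‖v‖ ∧
      dist (l • v) v = ‖v‖ - l * ‖v‖ := fun v => by
    refine ⟨by rw [dist_zero_left, norm_smul, Real.norm_of_nonneg hl.1], ?_⟩
    rw [dist_eq_norm, show l • v - v = (l - 1) • v by rw [sub_smul, one_smul], norm_smul,
      Real.norm_of_nonpos (by linarith [hl.2])]
    ring
  have := hX.2 p q r c c' hc hc' (l * dist p q)
    ⟨mul_nonneg hl.1 dist_nonneg, mul_le_of_le_one_left dist_nonneg hl.2⟩ (l * dist p r)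
    ⟨mul_nonneg hl.1 dist_nonneg, mul_le_of_le_one_left dist_nonneg hl.2⟩
    0 q' r' (l • q') (l • r') (by simp [hq]) (by simp [hr]) hqr
    (by rw [(key _).1, hq]) (by rw [(key _).2, hq]) (by rw [(key _).1, hr])
    (by rw [(key _).2, hr])
  rwa [dist_smul₀, hqr, Real.norm_of_nonneg hl.1] at this

/-- A point for which the triangle inequality is an equality lies on every geodesic. -/
lemma IsCATZero.eq_of_dist_add (hX : IsCATZero X) {x y z : X} {c : ℝ → X}
    (hc : IsGeodesic c x y) (h : dist x z + dist z y = dist x y) : c (dist x z) = z := by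
  obtain ⟨c', hc'⟩ := hX.1 x z
  have hz : dist x z ≤ dist x y := by linarith [dist_nonneg (x := z) (y := y)]
  -- The triangle `x, y, z` is degenerate, so its comparison triangle lies on a line, where the two
  -- comparison points coincide.
  let e : EuclideanSpace ℝ (Fin 2) := EuclideanSpace.single 0 1
  have he : ‖e‖ = 1 := by simp [e]
  have hd : ∀ a b : ℝ, dist (a • e) (b • e) = |a - b| := fun a b => by
    rw [dist_eq_norm, ← sub_smul, norm_smul, he, mul_one, Real.norm_eq_abs]
  have := hX.2 x y z c c' hc hc' (dist x z) ⟨dist_nonneg, hz⟩ (dist x z) ⟨dist_nonneg, le_rfl⟩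
    ((0 : ℝ) • e) (dist x y • e) (dist x z • e) (dist x z • e) (dist x z • e)
    (by rw [hd]; simp) (by rw [hd]; simp)
    (by rw [hd, abs_of_nonneg (by linarith), dist_comm y z]; linarith)
    (by rw [hd]; simp) (by rw [hd, abs_sub_comm, abs_of_nonneg (by linarith)])
    (by rw [hd]; simp) (by rw [hd]; simp)
  rw [dist_self, hc'.2.1] at this
  exact dist_le_zero.1 this

/-- Two geodesics issuing from `b` whose points at times `m` and `m'` are `K`-close stay close in
between. -/
lemma IsCATZero.dist_le_of_dist_le (hX : IsCATZero X) {b y z : X} {c c' : ℝ → X}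
    (hc : IsGeodesic c b y) (hc' : IsGeodesic c' b z) {K : ℝ} (hK : dist y z ≤ K) {r μ : ℝ}
    (hr : 0 ≤ r) (hμ : 0 < μ) (hrμ : r ≤ μ) (hy : μ ≤ dist b y) (hz : μ ≤ dist b z)
    (hμ' : μ = dist b y ∨ μ = dist b z) :
    dist (c r) (c' r) ≤ r / μ * (2 * K) := by
  have my : μ ∈ Icc 0 (dist b y) := ⟨hμ.le, hy⟩
  have mz : μ ∈ Icc 0 (dist b z) := ⟨hμ.le, hz⟩
  have e1 := hc.dist_left my
  have e2 := hc'.dist_left mz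
  -- One of the two points is an endpoint; the other is within `K` of its endpoint because the
  -- lengths differ by at most `K`.
  have key : dist (c μ) (c' μ) ≤ 2 * K := by
    have h1 := dist_triangle (c μ) y (c' μ)
    have h2 := dist_triangle y z (c' μ)
    have h3 := hc.dist_right my
    have h4 := hc'.dist_right mz
    rw [dist_comm z] at h2
    have h5 := abs_dist_sub_le y z b
    rw [abs_le, dist_comm y b, dist_comm z b] at h5
    rcases hμ' with h | h <;> linarith [h5.1, h5.2]
  have := hX.dist_le_mul (hc.initial my) (hc'.initial mz) (l := r / μ)
    ⟨by positivity, (div_le_one hμ).2 hrμ⟩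
  rw [e1, e2, div_mul_cancel₀ _ hμ.ne'] at this
  exact this.trans (mul_le_mul_of_nonneg_left key (by positivity))

/-- Metric balls in a geodesic CAT(0) space are connected. -/
lemma IsCATZero.isPreconnected_ball (hX : IsCATZero X) (x : X) (ε : ℝ) :
    IsPreconnected (Metric.ball x ε) := by
  apply isPreconnected_of_forall x
  intro y hy
  obtain ⟨c, hc⟩ := hX.1 x y
  refine ⟨c '' Icc 0 (dist x y), ?_, ⟨0, ⟨le_rfl, dist_nonneg⟩, hc.1⟩,
    ⟨_, ⟨dist_nonneg, le_rfl⟩, hc.2.1⟩, isPreconnected_Icc.image _ hc.continuousOn⟩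
  rintro _ ⟨t, ht, rfl⟩
  rw [Metric.mem_ball, dist_comm, hc.dist_left ht]
  rw [Metric.mem_ball, dist_comm] at hy
  exact ht.2.trans_lt hy

/-- Translation lengths at least double when an isometry is squared. -/
lemma IsCATZero.two_mul_le_dist_sq (hX : IsCATZero X) {h : X ≃ᵢ X} {l : ℝ}
    (hl : ∀ y, l ≤ dist y (h y)) (y : X) : 2 * l ≤ dist y ((h ^ 2) y) := by
  -- The midpoint `m` of `[y, h y]` and the midpoint `h m` of `[h y, h² y]` are at most half of
  -- `dist y (h² y)` apart.
  obtain ⟨c, hc⟩ := hX.1 y (h y)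
  have := hX.dist_le_mul hc.reverse (hc.map h) (l := 1 / 2) ⟨by norm_num, by norm_num⟩
  rw [dist_comm (h y) y, h.dist_eq] at this
  have e : dist y (h y) - 1 / 2 * dist y (h y) = 1 / 2 * dist y (h y) := by ring
  simp only [e] at this
  have h2 := hl (c (1 / 2 * dist y (h y)))
  rw [pow_two, IsometryEquiv.mul_apply]
  linarith

lemma IsCATZero.mul_le_dist_pow_two_pow (hX : IsCATZero X) {h : X ≃ᵢ X} {l : ℝ}
    (hl : ∀ y, l ≤ dist y (h y)) (k : ℕ) : ∀ y : X, 2 ^ k * l ≤ dist y ((h ^ 2 ^ k) y) := by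
  induction k with
  | zero => simpa using hl
  | succ k ih =>
    intro y
    have := hX.two_mul_le_dist_sq ih y
    rw [← pow_mul, ← pow_succ] at this
    calc _ = 2 * (2 ^ k * l) := by ring
      _ ≤ _ := this

lemma IsometryEquiv.dist_pow_le (h : X ≃ᵢ X) (x : X) (n : ℕ) :
    dist x ((h ^ n) x) ≤ n * dist x (h x) := by
  induction n with
  | zero => simp
  | succ n ih =>
    have := dist_triangle x ((h ^ n) x) ((h ^ (n + 1)) x)
    rw [pow_succ, IsometryEquiv.mul_apply, (h ^ n).dist_eq] at this
    rw [pow_succ, IsometryEquiv.mul_apply]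
    push_cast; linarith

/-- The orbit of a point of minimal displacement is a geodesic sequence. -/
lemma IsCATZero.dist_pow_of_forall_le (hX : IsCATZero X) {h : X ≃ᵢ X} {x : X}
    (hx : ∀ y, dist x (h x) ≤ dist y (h y)) (n : ℕ) :
    dist x ((h ^ n) x) = n * dist x (h x) := by
  apply le_antisymm (h.dist_pow_le x n)
  -- The lower bound is known at powers of two; a deficit at `n` would persist at `2 ^ n`.
  have hn : n ≤ 2 ^ n := Nat.lt_two_pow_self.le
  have h1 := hX.mul_le_dist_pow_two_pow hx n x
  have h2 := dist_triangle x ((h ^ n) x) ((h ^ 2 ^ n) x)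
  have h3 : dist ((h ^ n) x) ((h ^ 2 ^ n) x) ≤ (2 ^ n - n : ℝ) * dist x (h x) := by
    have := h.dist_pow_le x (2 ^ n - n)
    rw [← (h ^ n).dist_eq, ← IsometryEquiv.mul_apply, ← pow_add, Nat.add_sub_cancel' hn] at this
    simpa [Nat.cast_sub hn] using this
  linarith

end CATZeroBasics

/-! ### Rays, the cone topology, and limits of powers -/

section BoundaryBasics

variable {X : Type*} [MetricSpace X]

lemma GeodesicRay.dist_eq (c : GeodesicRay X) (s t : ℝ≥0) :
    dist (c.toFun s) (c.toFun t) = |(s : ℝ) - t| := by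
  rw [c.isometry.dist_eq, NNReal.dist_eq]

lemma GeodesicRay.dist_zero (c : GeodesicRay X) (t : ℝ≥0) :
    dist (c.toFun 0) (c.toFun t) = t := by
  rw [c.dist_eq]; simp

lemma GeodesicRay.isGeodesic (c : GeodesicRay X) (n : ℝ≥0) :
    IsGeodesic (fun t => c.toFun t.toNNReal) (c.toFun 0) (c.toFun n) := by
  refine ⟨by simp, by simp [c.dist_zero], fun s hs t ht => ?_⟩
  rw [c.dist_eq, Real.coe_toNNReal _ hs.1, Real.coe_toNNReal _ ht.1]

lemma GeodesicRay.endpoint_eq_iff {c c' : GeodesicRay X} :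
    c.endpoint = c'.endpoint ↔ ∃ K : ℝ, ∀ t, dist (c.toFun t) (c'.toFun t) ≤ K :=
  Quotient.eq (r := GeodesicRay.asymptotic X)

lemma GeodesicRay.dist_le_div_mul (hX : IsCATZero X) {c c' : GeodesicRay X}
    (h0 : c.toFun 0 = c'.toFun 0) {r t : ℝ≥0} (hrt : r ≤ t) :
    dist (c.toFun r) (c'.toFun r) ≤ r / t * dist (c.toFun t) (c'.toFun t) := by
  rcases eq_or_ne t 0 with rfl | ht
  · obtain rfl : r = 0 := le_antisymm hrt bot_le
    simp [h0]
  have ht' : (t : ℝ) ≠ 0 := by exact_mod_cast ht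
  have h2 := c'.isGeodesic t
  rw [← h0] at h2
  have := hX.dist_le_mul (c.isGeodesic t) h2 (l := r / t)
    ⟨by positivity, div_le_one_of_le₀ (by exact_mod_cast hrt) (by positivity)⟩
  rw [c.dist_zero, h0, c'.dist_zero, div_mul_cancel₀ _ ht'] at this
  simpa using this

lemma eq_zero_of_forall_le_div {a K : ℝ} (ha : 0 ≤ a) (r : ℝ)
    (h : ∀ n : ℕ, r ≤ n → a ≤ r / n * K) : a = 0 := by
  refine le_antisymm ?_ ha
  have hl : Tendsto (fun n : ℕ => r / n * K) atTop (𝓝 (0 * K)) :=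
    (tendsto_const_div_atTop_nhds_zero_nat r).mul_const K
  rw [zero_mul] at hl
  refine ge_of_tendsto hl ?_
  filter_upwards [eventually_ge_atTop ⌈r⌉₊] with n hn using h n (Nat.ceil_le.1 hn)

/-- A geodesic ray is determined by its origin and its endpoint. -/
lemma GeodesicRay.eq_of_endpoint_eq (hX : IsCATZero X) {c c' : GeodesicRay X}
    (h0 : c.toFun 0 = c'.toFun 0) (h : c.endpoint = c'.endpoint) (r : ℝ≥0) :
    c.toFun r = c'.toFun r := by
  obtain ⟨K, hK⟩ := GeodesicRay.endpoint_eq_iff.1 h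
  refine dist_eq_zero.1 (eq_zero_of_forall_le_div (K := K) dist_nonneg r fun n hn => ?_)
  refine (GeodesicRay.dist_le_div_mul hX h0 (t := n) (by exact_mod_cast hn)).trans ?_
  exact mul_le_mul_of_nonneg_left (hK _) (by positivity)

/-- Geodesics from a fixed point to points going to infinity subconverge to a ray. -/
lemma exists_ray_of_tendsto [ProperSpace X] {b : X} {y : ℕ → X} {γ : ℕ → ℝ → X}
    (hγ : ∀ n, IsGeodesic (γ n) b (y n)) (hy : Tendsto (fun n => dist b (y n)) atTop atTop) :
    ∃ c : GeodesicRay X, c.toFun 0 = b ∧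
      ∀ t : ℝ≥0, Tendsto (fun n => γ n t) (hyperfilter ℕ) (𝓝 (c.toFun t)) := by
  -- A nonprincipal ultrafilter gives convergence at all times at once, replacing a diagonal
  -- argument.
  have hle : (hyperfilter ℕ : Filter ℕ) ≤ atTop := Nat.hyperfilter_le_atTop
  have hev : ∀ t : ℝ≥0, ∀ᶠ n in (hyperfilter ℕ : Filter ℕ), (t : ℝ) ∈ Icc 0 (dist b (y n)) :=
    fun t => by
      filter_upwards [hle (hy.eventually_ge_atTop (t : ℝ))] with n hn using ⟨t.2, hn⟩
  have hlim : ∀ t : ℝ≥0, ∃ x, Tendsto (fun n => γ n t) (hyperfilter ℕ) (𝓝 x) := fun t => by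
    obtain ⟨x, -, hx⟩ := (isCompact_closedBall b (t : ℝ)).ultrafilter_le_nhds
      ((hyperfilter ℕ).map fun n => γ n t) (by
        rw [le_principal_iff, Ultrafilter.coe_map, mem_map]
        filter_upwards [hev t] with n hn
        rw [mem_preimage, Metric.mem_closedBall, dist_comm, (hγ n).dist_left hn])
    exact ⟨x, hx⟩
  choose f hf using hlim
  refine ⟨⟨f, Isometry.of_dist_eq fun s t => ?_⟩, ?_, hf⟩
  · refine tendsto_nhds_unique ((hf s).dist (hf t)) (tendsto_const_nhds.congr' ?_)
    filter_upwards [hev s, hev t] with n hs ht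
    rw [(hγ n).2.2 _ hs _ ht, NNReal.dist_eq]
  · refine tendsto_nhds_unique (hf 0) (tendsto_const_nhds.congr fun n => ?_)
    rw [NNReal.coe_zero, (hγ n).1]

/-- Every point of the boundary is represented by a ray from any given point. -/
lemma GeodesicRay.exists_asymptotic [ProperSpace X] (hX : IsCATZero X) (c : GeodesicRay X)
    (b : X) : ∃ c' : GeodesicRay X, c'.toFun 0 = b ∧ c'.endpoint = c.endpoint ∧
      ∀ t, dist (c'.toFun t) (c.toFun t) ≤ 2 * dist b (c.toFun 0) := by
  set K := dist b (c.toFun 0) with hK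
  choose γ hγ using fun n : ℕ => hX.1 b (c.toFun n)
  have hL : ∀ n : ℕ, |dist b (c.toFun n) - n| ≤ K := fun n => by
    have := abs_dist_sub_le b (c.toFun 0) (c.toFun n)
    rwa [c.dist_zero] at this
  have htop : Tendsto (fun n : ℕ => dist b (c.toFun n)) atTop atTop := by
    refine tendsto_atTop_mono (f := fun n : ℕ => (n : ℝ) - K) (fun n => ?_)
      (tendsto_atTop_add_const_right _ _ tendsto_natCast_atTop_atTop)
    linarith [(abs_le.1 (hL n)).1]
  obtain ⟨c', h0, hlim⟩ := exists_ray_of_tendsto hγ htop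
  have hd : ∀ t, dist (c'.toFun t) (c.toFun t) ≤ 2 * K := fun t => by
    refine le_of_tendsto ((hlim t).dist tendsto_const_nhds) ?_
    filter_upwards [Nat.hyperfilter_le_atTop (htop.eventually_ge_atTop (t : ℝ)),
      Nat.hyperfilter_le_atTop (eventually_ge_atTop (⌈(t : ℝ)⌉₊ + 1))] with n hn hn'
    have htn : (t : ℝ) + 1 ≤ n := by
      have := Nat.le_ceil (t : ℝ)
      have h2 : ((⌈(t : ℝ)⌉₊ + 1 : ℕ) : ℝ) ≤ n := by exact_mod_cast hn'
      push_cast at h2; linarith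
    have hn0 : (0 : ℝ) < n := by linarith [t.2]
    have hl1 : (t : ℝ) / n ≤ 1 := (div_le_one hn0).2 (by linarith)
    have hl0 : 0 ≤ (t : ℝ) / n := by positivity
    -- Seen from `c n`, the ratio `1 - t / n` hits time `t` on `c` exactly, but time `t / n * dist b
    -- (c n)` on `γ n`; this is within `t / n * K` of `t`.
    have h1 := hX.dist_le_mul (hγ n).reverse (c.isGeodesic n).reverse (l := 1 - t / n)
      ⟨by linarith, by linarith⟩
    have e0 := c.dist_zero n
    rw [dist_comm (c.toFun n) b, dist_comm (c.toFun n) (c.toFun 0), e0, NNReal.coe_natCast] at h1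
    have e1 : dist b (c.toFun n) - (1 - t / n) * dist b (c.toFun n) =
      t / n * dist b (c.toFun n) := by ring
    have e2 : (n : ℝ) - (1 - t / n) * n = t := by field_simp; ring
    simp only [e1, e2, Real.toNNReal_coe] at h1
    have h2 := (hγ n).2.2 t ⟨t.2, hn⟩ (t / n * dist b (c.toFun n))
      ⟨by positivity, mul_le_of_le_one_left dist_nonneg hl1⟩
    have h3 : |(t : ℝ) - t / n * dist b (c.toFun n)| ≤ t / n * K := by
      rw [show (t : ℝ) - t / n * dist b (c.toFun n) = t / n * -(dist b (c.toFun n) - n) by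
        field_simp; ring, abs_mul, abs_of_nonneg hl0, abs_neg]
      exact mul_le_mul_of_nonneg_left (hL n) hl0
    have h4 := dist_triangle (γ n t) (γ n (t / n * dist b (c.toFun n))) (c.toFun t)
    rw [← hK] at h1
    have hK0 : 0 ≤ K := dist_nonneg
    nlinarith
  exact ⟨c', h0, GeodesicRay.endpoint_eq_iff.2 ⟨_, hd⟩, hd⟩

/-- Subbasic neighbourhoods suffice: open sets of `X` contain no ideal point, and uniqueness of the
ray from `b` reduces `coneNhd` to a condition at a single time. -/
lemma tendsto_ideal (hX : IsCATZero X) {b : X} {c : GeodesicRay X} (hc : c.toFun 0 = b)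
    {σ : ℕ → GeodesicRay X} (hσ : ∀ n, (σ n).toFun 0 = b)
    (h : ∀ r, Tendsto (fun n => (σ n).toFun r) atTop (𝓝 (c.toFun r))) :
    Tendsto (fun n => Bordification.ideal (σ n).endpoint) atTop
      (@nhds _ (coneTopology b) (Bordification.ideal c.endpoint)) := by
  rw [TopologicalSpace.tendsto_nhds_generateFrom_iff]
  rintro s (⟨O, -, rfl⟩ | ⟨d, r, ε, hd, -, -, rfl⟩) hs
  · obtain ⟨x, -, hx⟩ := hs
    cases hx
  · obtain ⟨c', h0, h1, h2⟩ := hs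
    rw [GeodesicRay.eq_of_endpoint_eq hX (h0.trans (hd.trans hc.symm)) h1 r] at h2
    filter_upwards [((h r).dist tendsto_const_nhds).eventually_lt_const h2] with n hn
    exact ⟨σ n, (hσ n).trans hd.symm, rfl, hn⟩

lemma tendsto_point (hX : IsCATZero X) {b : X} {c : GeodesicRay X} (hc : c.toFun 0 = b)
    {y : ℕ → X} {γ : ℕ → ℝ → X} (hγ : ∀ n, IsGeodesic (γ n) b (y n))
    (hy : Tendsto (fun n => dist b (y n)) atTop atTop)
    (h : ∀ r : ℝ≥0, Tendsto (fun n => γ n r) atTop (𝓝 (c.toFun r))) :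
    Tendsto (fun n => Bordification.point (y n)) atTop
      (@nhds _ (coneTopology b) (Bordification.ideal c.endpoint)) := by
  rw [TopologicalSpace.tendsto_nhds_generateFrom_iff]
  rintro s (⟨O, -, rfl⟩ | ⟨d, r, ε, hd, -, -, rfl⟩) hs
  · obtain ⟨x, -, hx⟩ := hs
    cases hx
  · obtain ⟨c', h0, h1, h2⟩ := hs
    rw [GeodesicRay.eq_of_endpoint_eq hX (h0.trans (hd.trans hc.symm)) h1 r] at h2
    filter_upwards [((h r).dist tendsto_const_nhds).eventually_lt_const h2,
      hy.eventually_gt_atTop (r : ℝ)] with n hn hn'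
    subst hd
    exact ⟨hn', γ n, hγ n, hn⟩

lemma mem_closure_boundaryTopology (hX : IsCATZero X) {b : X} {A : Set (VisualBoundary X)}
    {c : GeodesicRay X} (hc : c.toFun 0 = b)
    {σ : ℕ → GeodesicRay X} (hσ : ∀ n, (σ n).toFun 0 = b) (hA : ∀ n, (σ n).endpoint ∈ A)
    (h : ∀ r, Tendsto (fun n => (σ n).toFun r) atTop (𝓝 (c.toFun r))) :
    c.endpoint ∈ closure[boundaryTopology b] A := by
  let _ := coneTopology b
  let _ := boundaryTopology b
  refine mem_closure_of_tendsto (f := fun n => (σ n).endpoint) (b := atTop) ?_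
    (Eventually.of_forall hA)
  rw [nhds_induced, tendsto_comap_iff]
  exact tendsto_ideal hX hc hσ h

lemma tendsto_of_forall_dist_le_div {f : ℕ → X} {x : X} {r K L : ℝ} (hL : 0 < L) (A : ℝ)
    (h : ∀ᶠ n : ℕ in atTop, dist (f n) x ≤ r / (n * L - A) * K) :
    Tendsto f atTop (𝓝 x) := by
  rw [tendsto_iff_dist_tendsto_zero]
  refine squeeze_zero' (Eventually.of_forall fun _ => dist_nonneg) h ?_
  rw [← zero_mul K]
  refine Tendsto.mul_const K (Tendsto.div_atTop tendsto_const_nhds ?_)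
  exact tendsto_atTop_add_const_right _ _ (tendsto_natCast_atTop_atTop.atTop_mul_const hL)

/-- Rays from `b` passing within bounded distance of points of a ray `c` that go to infinity
converge to `c`. -/
lemma tendsto_ray_of_dist_le (hX : IsCATZero X) {c : GeodesicRay X} {σ : ℕ → GeodesicRay X}
    (hσ : ∀ n, (σ n).toFun 0 = c.toFun 0) {K : ℝ}
    (h : ∀ n : ℕ, ∃ t, dist ((σ n).toFun t) (c.toFun n) ≤ K) (r : ℝ≥0) :
    Tendsto (fun n => (σ n).toFun r) atTop (𝓝 (c.toFun r)) := by
  refine tendsto_of_forall_dist_le_div (r := r) (K := 2 * K) (L := 1) one_pos 0 ?_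
  filter_upwards [eventually_ge_atTop ⌈(r : ℝ)⌉₊] with n hn
  obtain ⟨t, ht⟩ := h n
  -- The time `t` differs from `n` by at most `K`, which costs a second `K`.
  have h1 : dist ((σ n).toFun n) (c.toFun n) ≤ 2 * K := by
    have h2 := dist_triangle ((σ n).toFun n) ((σ n).toFun t) (c.toFun n)
    have h3 := abs_dist_sub_le ((σ n).toFun t) (c.toFun n) (c.toFun 0)
    rw [dist_comm _ (c.toFun 0), dist_comm _ (c.toFun 0), c.dist_zero, ← hσ n,
      (σ n).dist_zero] at h3
    rw [(σ n).dist_eq, abs_sub_comm] at h2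
    linarith
  have h4 := GeodesicRay.dist_le_div_mul hX (hσ n) (r := r) (t := n)
    (by exact_mod_cast Nat.ceil_le.1 hn)
  refine h4.trans ?_
  simp only [mul_one, sub_zero, NNReal.coe_natCast]
  exact mul_le_mul_of_nonneg_left h1 (by positivity)

/-- A geodesic from the origin of a ray to a point close to the ray stays close to the ray. -/
lemma GeodesicRay.dist_geodesic_le (hX : IsCATZero X) {c : GeodesicRay X} {y : X} {γ : ℝ → X}
    (hγ : IsGeodesic γ (c.toFun 0) y) {m : ℝ≥0} {K : ℝ} (hK : dist y (c.toFun m) ≤ K) {r : ℝ≥0}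
    (hr : r ≤ m - K) (hm : 0 < m - K) :
    dist (γ r) (c.toFun r) ≤ r / (m - K) * (2 * K) := by
  have hK0 : 0 ≤ K := dist_nonneg.trans hK
  have h1 := abs_dist_sub_le y (c.toFun m) (c.toFun 0)
  rw [dist_comm _ (c.toFun 0), dist_comm _ (c.toFun 0), c.dist_zero, abs_le] at h1
  set d := dist (c.toFun 0) y with hd
  have hμ : m - K ≤ min d m := le_min (by linarith) (by linarith)
  have := hX.dist_le_of_dist_le hγ (c.isGeodesic m) hK (r := r) (μ := min d m) r.2
    (by linarith) (by linarith) (min_le_left _ _) (by rw [c.dist_zero]; exact min_le_right _ _)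
    (by rw [c.dist_zero]; exact min_choice _ _)
  rw [Real.toNNReal_coe] at this
  refine this.trans (mul_le_mul_of_nonneg_right ?_ (by positivity))
  exact div_le_div_of_nonneg_left r.2 hm hμ

/-- If some orbit of `⟨h⟩` stays close to a ray, then `h ^ ∞` is the endpoint of the ray. -/
lemma isInfinitePower_of_dist_le [ProperSpace X] (hX : IsCATZero X) {h : X ≃ᵢ X} {p : X}
    {c : GeodesicRay X} {L : ℝ≥0} (hL : 0 < L) {K : ℝ}
    (hK : ∀ n : ℕ, dist ((h ^ n) p) (c.toFun (n * L)) ≤ K) :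
    IsInfinitePower h c.endpoint := by
  intro b x
  obtain ⟨c', h0, h1, h2⟩ := c.exists_asymptotic hX b
  set K' := dist x p + K + 2 * dist b (c.toFun 0)
  have hd : ∀ n : ℕ, dist ((h ^ n) x) (c'.toFun (n * L)) ≤ K' := fun n => by
    have e1 := dist_triangle ((h ^ n) x) ((h ^ n) p) (c'.toFun (n * L))
    have e2 := dist_triangle ((h ^ n) p) (c.toFun (n * L)) (c'.toFun (n * L))
    have e3 := h2 (n * L)
    rw [dist_comm] at e3
    rw [(h ^ n).dist_eq] at e1
    linarith [hK n]
  choose γ hγ using fun n : ℕ => hX.1 b ((h ^ n) x)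
  have hL' : (0 : ℝ) < L := hL
  have htop : Tendsto (fun n : ℕ => (n : ℝ) * L - K') atTop atTop :=
    tendsto_atTop_add_const_right _ _ (tendsto_natCast_atTop_atTop.atTop_mul_const hL')
  rw [← h1]
  refine tendsto_point hX h0 hγ (tendsto_atTop_mono (fun n => ?_) htop) fun r => ?_
  · have e1 := dist_triangle b ((h ^ n) x) (c'.toFun (n * L))
    have e2 := c'.dist_zero (n * L)
    rw [h0] at e2
    push_cast at e2
    linarith [hd n]
  · refine tendsto_of_forall_dist_le_div (r := r) (K := 2 * K') hL' K' ?_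
    filter_upwards [htop.eventually_ge_atTop (r : ℝ), htop.eventually_gt_atTop 0] with n hn hn'
    have hγ' := hγ n
    rw [← h0] at hγ'
    have := GeodesicRay.dist_geodesic_le hX hγ' (hd n) (r := r)
      (by push_cast; exact hn) (by push_cast; exact hn')
    push_cast at this
    exact this

/-- A fixed-point-free isometry of minimal displacement at `x` translates a ray issuing from
`x`. -/
lemma exists_ray_of_forall_dist_le [ProperSpace X] (hX : IsCATZero X) {h : X ≃ᵢ X} {x : X}
    (hx : ∀ y, dist x (h x) ≤ dist y (h y)) (hx' : h x ≠ x) :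
    ∃ (c : GeodesicRay X) (L : ℝ≥0), 0 < L ∧ ∀ n : ℕ, c.toFun (n * L) = (h ^ n) x := by
  have hpow := hX.dist_pow_of_forall_le hx
  set L : ℝ≥0 := ⟨dist x (h x), dist_nonneg⟩ with hLdef
  have hL : (L : ℝ) = dist x (h x) := rfl
  have hL0 : (0 : ℝ) < L := dist_pos.2 hx'.symm
  choose γ hγ using fun n : ℕ => hX.1 x ((h ^ n) x)
  have htop : Tendsto (fun n : ℕ => dist x ((h ^ n) x)) atTop atTop := by
    simp only [hpow]
    exact tendsto_natCast_atTop_atTop.atTop_mul_const hL0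
  obtain ⟨c, -, hlim⟩ := exists_ray_of_tendsto hγ htop
  refine ⟨c, L, hL0, fun k => ?_⟩
  refine tendsto_nhds_unique (hlim _) (tendsto_const_nhds.congr' ?_)
  filter_upwards [Nat.hyperfilter_le_atTop (eventually_ge_atTop k)] with n hn
  -- The point `h ^ k x` lies on the geodesic from `x` to `h ^ n x`, so the sequence at time `k L`
  -- is eventually constant.
  have e : dist ((h ^ k) x) ((h ^ n) x) = ((n : ℝ) - k) * dist x (h x) := by
    obtain ⟨m, rfl⟩ := Nat.exists_eq_add_of_le hn
    rw [pow_add, IsometryEquiv.mul_apply, (h ^ k).dist_eq, hpow]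
    push_cast; ring
  have := hX.eq_of_dist_add (hγ n) (z := (h ^ k) x) (by rw [e, hpow, hpow]; ring)
  rw [hpow] at this
  rw [← this]
  simp [hL]

lemma VisualBoundary.map_endpoint (g : X ≃ᵢ X) (c : GeodesicRay X) :
    VisualBoundary.map g c.endpoint = (c.map g).endpoint := rfl

end BoundaryBasics

/-! ### Walls, half-spaces and separation -/

section ReflectionBasics

variable {X : Type*} [MetricSpace X]

lemma isClosed_wall (r : X ≃ᵢ X) : IsClosed (wall r) :=
  isClosed_eq r.continuous continuous_id

lemma wall_conj (g r : X ≃ᵢ X) : wall (g * r * g⁻¹) = g '' wall r := by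
  ext x
  constructor
  · intro h
    refine ⟨g⁻¹ x, ?_, g.apply_inv_self x⟩
    have h' : g (r (g⁻¹ x)) = x := h
    apply g.injective
    rw [h', IsometryEquiv.apply_inv_self]
  · rintro ⟨y, hy, rfl⟩
    have hy' : r y = y := hy
    simp [wall, IsometryEquiv.mul_apply, hy']

lemma wall_compl_conj (g r : X ≃ᵢ X) : (wall (g * r * g⁻¹))ᶜ = g '' (wall r)ᶜ := by
  rw [wall_conj, image_compl_eq g.bijective]

lemma IsometryEquiv.image_connectedComponentIn (g : X ≃ᵢ X) {U : Set X} {x : X} (hx : x ∈ U) :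
    g '' connectedComponentIn U x = connectedComponentIn (g '' U) (g x) :=
  g.toHomeomorph.image_connectedComponentIn hx

lemma halfSpace_conj (g r : X ≃ᵢ X) {x : X} (hx : x ∉ wall r) :
    halfSpace (g x) (g * r * g⁻¹) = g '' halfSpace x r := by
  rw [halfSpace, halfSpace, wall_compl_conj, g.image_connectedComponentIn hx]

lemma IsGeodesicallyConvex.image {A : Set X} (hA : IsGeodesicallyConvex A) (g : X ≃ᵢ X) :
    IsGeodesicallyConvex (g '' A) := by
  rintro _ ⟨x, hx, rfl⟩ _ ⟨y, hy, rfl⟩ c hc t ht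
  rw [g.dist_eq] at ht
  have := hc.map g⁻¹
  rw [IsometryEquiv.inv_apply_self, IsometryEquiv.inv_apply_self] at this
  exact ⟨_, hA x hx y hy _ this t ht, g.apply_inv_self _⟩

lemma componentsIn_image (g : X ≃ᵢ X) (U : Set X) :
    componentsIn (g '' U) = (fun A => g '' A) '' componentsIn U := by
  ext A
  constructor
  · rintro ⟨_, ⟨x, hx, rfl⟩, rfl⟩
    exact ⟨_, ⟨x, hx, rfl⟩, g.image_connectedComponentIn hx⟩
  · rintro ⟨_, ⟨x, hx, rfl⟩, rfl⟩
    exact ⟨g x, mem_image_of_mem _ hx, g.image_connectedComponentIn hx⟩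

lemma IsReflection.conj {r : X ≃ᵢ X} (hr : IsReflection r) (g : X ≃ᵢ X) :
    IsReflection (g * r * g⁻¹) := by
  obtain ⟨h1, h2, A, B, hne, hc, hA, hB, hAB, hBA⟩ := hr
  have himg : ∀ {A B : Set X}, r '' A = B → (g * r * g⁻¹ : X ≃ᵢ X) '' (g '' A) = g '' B := by
    rintro A _ rfl
    simp only [image_image, IsometryEquiv.mul_apply, IsometryEquiv.inv_apply_self]
  refine ⟨by rw [conj_pow, h1, mul_one, mul_inv_cancel], ?_, g '' A, g '' B,
    fun h => hne (g.injective.image_injective h), ?_, hA.image g, hB.image g,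
    himg hAB, himg hBA⟩
  · rw [wall_conj]
    have := g.toHomeomorph.image_interior (wall r)
    rw [h2, image_empty] at this
    exact this.symm
  · rw [wall_compl_conj, componentsIn_image, hc, image_pair]

lemma IsReflection.mul_self {r : X ≃ᵢ X} (hr : IsReflection r) : r * r = 1 := by
  rw [← pow_two]; exact hr.1

lemma IsReflection.inv_eq {r : X ≃ᵢ X} (hr : IsReflection r) : r⁻¹ = r :=
  inv_eq_of_mul_eq_one_left hr.mul_self

lemma IsReflection.apply_apply {r : X ≃ᵢ X} (hr : IsReflection r) (x : X) : r (r x) = x := by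
  rw [← IsometryEquiv.mul_apply, hr.mul_self]; rfl

lemma IsReflection.mul_mul_cancel {r : X ≃ᵢ X} (hr : IsReflection r) (v : X ≃ᵢ X) :
    r * (r * v) = v := by
  rw [← mul_assoc, hr.mul_self, one_mul]

lemma apply_mem_wall_iff {r : X ≃ᵢ X} {x : X} :
    r x ∈ wall r ↔ x ∈ wall r := by
  constructor
  · intro h
    have h' : r (r x) = r x := h
    exact r.injective h'
  · intro h
    have h' : r x = x := h
    rwa [h']

lemma halfSpace_subset (x : X) (r : X ≃ᵢ X) : halfSpace x r ⊆ (wall r)ᶜ :=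
  connectedComponentIn_subset _ _

lemma mem_halfSpace_self {x : X} {r : X ≃ᵢ X} (hx : x ∉ wall r) : x ∈ halfSpace x r :=
  mem_connectedComponentIn hx

lemma halfSpace_eq {x y : X} {r : X ≃ᵢ X} (h : y ∈ halfSpace x r) :
    halfSpace x r = halfSpace y r := connectedComponentIn_eq h

lemma IsReflection.convex_halfSpace {r : X ≃ᵢ X} (hr : IsReflection r) {x : X}
    (hx : x ∉ wall r) : IsGeodesicallyConvex (halfSpace x r) := by
  obtain ⟨-, -, A, B, -, hc, hA, hB, -, -⟩ := hr
  have : halfSpace x r ∈ ({A, B} : Set (Set X)) := hc ▸ ⟨x, hx, rfl⟩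
  rcases this with h | h
  · rwa [h]
  · rw [mem_singleton_iff.1 h]; exact hB

/-- There are only two components and `r` swaps them; the work is to identify the component of `r y`
with the image of that of `y`. -/
lemma IsReflection.apply_mem_halfSpace_iff {r : X ≃ᵢ X} (hr : IsReflection r) {x y : X}
    (hx : x ∉ wall r) (hy : y ∉ wall r) : r y ∈ halfSpace x r ↔ y ∉ halfSpace x r := by
  have hry : r y ∉ wall r := fun h => hy (apply_mem_wall_iff.1 h)
  obtain ⟨-, -, A, B, hne, hc, -, -, hAB, hBA⟩ := hr
  have hm : ∀ z, z ∉ wall r → halfSpace z r = A ∨ halfSpace z r = B := fun z hz => by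
    have : halfSpace z r ∈ ({A, B} : Set (Set X)) := hc ▸ ⟨z, hz, rfl⟩
    simpa using this
  have hswap : ∀ z, z ∉ wall r → r '' halfSpace z r ≠ halfSpace z r ∧
      (r '' halfSpace z r = A ∨ r '' halfSpace z r = B) := fun z hz => by
    rcases hm z hz with h | h
    · rw [h, hAB]; exact ⟨hne.symm, Or.inr rfl⟩
    · rw [h, hBA]; exact ⟨hne, Or.inl rfl⟩
  have hry' : halfSpace (r y) r = r '' halfSpace y r := by
    have h1 : r y ∈ r '' halfSpace y r := mem_image_of_mem _ (mem_halfSpace_self hy)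
    have : ∃ z ∈ (wall r)ᶜ, r '' halfSpace y r = connectedComponentIn (wall r)ᶜ z := by
      have : r '' halfSpace y r ∈ componentsIn (wall r)ᶜ := by
        rw [hc]; simpa using (hswap y hy).2
      exact this
    obtain ⟨z, -, hz⟩ := this
    rw [hz] at h1 ⊢
    exact (connectedComponentIn_eq h1).symm
  constructor
  · intro h1 h2
    have e1 := halfSpace_eq h1
    have e2 := halfSpace_eq h2
    exact (hswap y hy).1 (by rw [← hry', ← e1, e2])
  · intro h
    have h1 : halfSpace y r ≠ halfSpace x r := fun h1 => h (h1 ▸ mem_halfSpace_self hy)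
    have h2 : halfSpace (r y) r = halfSpace x r := by
      have h3 := (hswap y hy).1
      rw [← hry'] at h3
      rcases hm x hx with a | a <;> rcases hm y hy with b | b <;> rcases hm _ hry with c | c <;>
        simp_all
    exact h2 ▸ mem_halfSpace_self hry

/-- The points `x` and `y` lie strictly on different sides of the wall of `r`. -/
def Separates (r : X ≃ᵢ X) (x y : X) : Prop := x ∉ wall r ∧ y ∉ wall r ∧ y ∉ halfSpace x r

lemma Separates.symm {r : X ≃ᵢ X} {x y : X} (h : Separates r x y) : Separates r y x :=
  ⟨h.2.1, h.1, fun h' => h.2.2 (halfSpace_eq h' ▸ mem_halfSpace_self h.2.1)⟩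

lemma not_separates_iff {r : X ≃ᵢ X} {x y : X} (hx : x ∉ wall r) (hy : y ∉ wall r) :
    ¬ Separates r x y ↔ y ∈ halfSpace x r := by
  simp [Separates, hx, hy]

lemma Separates.or {r : X ≃ᵢ X} {x y z : X} (h : Separates r x z) (hy : y ∉ wall r) :
    Separates r x y ∨ Separates r y z := by
  by_contra! hc
  rw [not_separates_iff h.1 hy, not_separates_iff hy h.2.1] at hc
  exact h.2.2 (halfSpace_eq hc.1 ▸ hc.2)

lemma Separates.conj {r : X ≃ᵢ X} {x y : X} (h : Separates r x y) (g : X ≃ᵢ X) :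
    Separates (g * r * g⁻¹) (g x) (g y) := by
  refine ⟨?_, ?_, ?_⟩
  · rw [wall_conj, g.injective.mem_set_image]; exact h.1
  · rw [wall_conj, g.injective.mem_set_image]; exact h.2.1
  · rw [halfSpace_conj g r h.1, g.injective.mem_set_image]; exact h.2.2

lemma IsReflection.separates_apply_iff {r : X ≃ᵢ X} (hr : IsReflection r) {x y : X}
    (hx : x ∉ wall r) (hy : y ∉ wall r) : Separates r x (r y) ↔ ¬ Separates r x y := by
  rw [not_separates_iff hx hy]
  have : r y ∉ wall r := fun h => hy (apply_mem_wall_iff.1 h)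
  have h2 := hr.apply_mem_halfSpace_iff hx hy
  simp only [Separates, hx, this, not_false_eq_true, true_and]
  tauto

lemma Separates.exists_mem_wall {r : X ≃ᵢ X} {x y : X} (h : Separates r x y) {c : ℝ → X}
    (hc : IsGeodesic c x y) : ∃ t ∈ Icc 0 (dist x y), c t ∈ wall r := by
  by_contra! hcon
  apply h.2.2
  have hx : x ∈ c '' Icc 0 (dist x y) := ⟨0, ⟨le_rfl, dist_nonneg⟩, hc.1⟩
  refine (isPreconnected_Icc.image _ hc.continuousOn).subset_connectedComponentIn hx ?_
    ⟨dist x y, ⟨dist_nonneg, le_rfl⟩, hc.2.1⟩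
  rintro _ ⟨t, ht, rfl⟩
  exact hcon t ht

lemma IsCATZero.ball_subset_halfSpace (hX : IsCATZero X) {r : X ≃ᵢ X} {x y : X} {ε : ℝ}
    (h : Disjoint (Metric.ball y ε) (wall r)) (hx : y ∈ halfSpace x r) :
    Metric.ball y ε ⊆ halfSpace x r := by
  rcases le_or_gt ε 0 with hε | hε
  · rw [Metric.ball_eq_empty.2 hε]; exact empty_subset _
  rw [halfSpace_eq hx]
  exact (hX.isPreconnected_ball y ε).subset_connectedComponentIn (Metric.mem_ball_self hε)
    h.subset_compl_right

lemma IsCATZero.isOpen_halfSpace (hX : IsCATZero X) (x : X) (r : X ≃ᵢ X) : IsOpen (halfSpace x r) := by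
  rw [Metric.isOpen_iff]
  intro y hy
  obtain ⟨ε, hε, h⟩ := Metric.isOpen_iff.1 (isClosed_wall r).isOpen_compl y
    (halfSpace_subset _ _ hy)
  exact ⟨ε, hε, hX.ball_subset_halfSpace (subset_compl_iff_disjoint_right.1 h) hy⟩

/-- Geodesics are unique, so an isometry fixing both ends of one fixes it pointwise. -/
lemma IsCATZero.convex_wall (hX : IsCATZero X) (r : X ≃ᵢ X) : IsGeodesicallyConvex (wall r) := by
  intro x hx y hy c hc t ht
  have hx' : r x = x := hx
  have hy' : r y = y := hy
  have e1 : dist x (r (c t)) = t := by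
    have := r.dist_eq x (c t)
    rwa [hx', hc.dist_left ht] at this
  have e2 : dist (r (c t)) y = dist x y - t := by
    have := r.dist_eq (c t) y
    rwa [hy', hc.dist_right ht] at this
  have := hX.eq_of_dist_add hc (z := r (c t)) (by rw [e1, e2]; ring)
  rw [e1] at this
  exact this.symm

/-- Folding along a wall strictly decreases distances. -/
lemma Separates.dist_lt (hX : IsCATZero X) {r : X ≃ᵢ X} (hr : IsReflection r) {x y : X} (h : Separates r x y) :
    dist x (r y) < dist x y := by
  -- Folding the geodesic at its wall point gives a path of the same length from `x` to `r y`. Were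
  -- it a geodesic, it would join two points of a convex half-space through the wall.
  by_contra! hle
  obtain ⟨c, hc⟩ := hX.1 x y
  obtain ⟨t, ht, hw⟩ := h.exists_mem_wall hc
  have hw' : r (c t) = c t := hw
  have hry : r y ∈ halfSpace x r := (hr.apply_mem_halfSpace_iff h.1 h.2.1).2 h.2.2
  have e1 := hc.dist_left ht
  have e2 : dist (c t) (r y) = dist x y - t := by
    have := r.dist_eq (c t) y
    rwa [hw', hc.dist_right ht] at this
  have e3 : dist x (r y) = dist x y := by
    linarith [dist_triangle x (c t) (r y)]
  obtain ⟨c', hc'⟩ := hX.1 x (r y)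
  have := hX.eq_of_dist_add hc' (z := c t) (by rw [e1, e2, e3]; ring)
  rw [e1] at this
  have h2 := hr.convex_halfSpace h.1 x (mem_halfSpace_self h.1) _ hry c' hc' t (e3 ▸ ht)
  rw [this] at h2
  exact halfSpace_subset _ _ h2 hw

end ReflectionBasics

/-! ### Local finiteness of walls; nearest and farthest orbit points -/

section ProperActions

variable {X : Type*} [MetricSpace X] {W : Subgroup (X ≃ᵢ X)}

lemma ActsProperly.finite_setOf_dist_le (hW : ActsProperly W) (x y : X) (N : ℝ) :
    {g : X ≃ᵢ X | g ∈ W ∧ dist (g x) y ≤ N}.Finite := by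
  refine (hW x (|N| + dist x y + 1) (by positivity)).subset fun g hg => ⟨hg.1, ?_⟩
  rw [Metric.mem_ball]
  have := dist_triangle (g x) y x
  rw [dist_comm y x] at this
  linarith [hg.2, le_abs_self N]

lemma ActsProperly.exists_minimal_dist (hW : ActsProperly W) (x y : X)
    {A : Set (X ≃ᵢ X)} (hA : A ⊆ W) (hne : A.Nonempty) :
    ∃ g ∈ A, ∀ h ∈ A, dist x (g y) ≤ dist x (h y) := by
  obtain ⟨g₀, hg₀⟩ := hne
  have hfin : {g | g ∈ A ∧ dist (g y) x ≤ dist (g₀ y) x}.Finite :=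
    (hW.finite_setOf_dist_le y x (dist (g₀ y) x)).subset fun g hg => ⟨hA hg.1, hg.2⟩
  obtain ⟨g, hg, hmin⟩ := hfin.exists_minimalFor (fun g => dist (g y) x) _ ⟨g₀, hg₀, le_rfl⟩
  refine ⟨g, hg.1, fun h hh => ?_⟩
  rw [dist_comm x, dist_comm x]
  rcases le_total (dist (g y) x) (dist (h y) x) with hle | hle
  · exact hle
  · exact hmin ⟨hh, hle.trans hg.2⟩ hle

lemma reflectionsIn_conj {g r : X ≃ᵢ X} (hg : g ∈ W) (hr : r ∈ reflectionsIn W) :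
    g * r * g⁻¹ ∈ reflectionsIn W :=
  ⟨W.mul_mem (W.mul_mem hg hr.1) (W.inv_mem hg), hr.2.conj g⟩

/-- Walls are permuted by the group. -/
lemma notMem_wall_apply {g : X ≃ᵢ X} (hg : g ∈ W) {y : X}
    (hy : ∀ r ∈ reflectionsIn W, y ∉ wall r) : ∀ r ∈ reflectionsIn W, g y ∉ wall r := by
  intro r hr h
  apply hy _ (reflectionsIn_conj (W.inv_mem hg) hr)
  rw [wall_conj]
  exact ⟨_, h, IsometryEquiv.inv_apply_self g y⟩

/-- A reflection fixing a point of the ball moves the centre by less than `2 * N`. -/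
lemma ActsProperly.finite_walls (hW : ActsProperly W) (x : X) (N : ℝ) :
    {r | r ∈ reflectionsIn W ∧ (Metric.ball x N ∩ wall r).Nonempty}.Finite := by
  refine (hW.finite_setOf_dist_le x x (2 * N)).subset ?_
  rintro r ⟨hr, z, hz, hzr⟩
  refine ⟨hr.1, ?_⟩
  have hzr' : r z = z := hzr
  have h1 := dist_triangle (r x) z x
  have h2 := r.dist_eq x z
  rw [Metric.mem_ball] at hz
  rw [hzr', dist_comm x z] at h2
  linarith

lemma ActsProperly.exists_ball_disjoint_walls (hW : ActsProperly W) (x : X) :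
    ∃ ε > 0, ∀ r ∈ reflectionsIn W, x ∉ wall r → Disjoint (Metric.ball x ε) (wall r) := by
  have hfin := (hW.finite_walls x 1).subset
    (sep_subset _ fun r => x ∉ wall r)
  have hcl : IsClosed (⋃ r ∈ {r | (r ∈ reflectionsIn W ∧ (Metric.ball x 1 ∩ wall r).Nonempty) ∧
      x ∉ wall r}, wall r) := hfin.isClosed_biUnion fun r _ => isClosed_wall r
  obtain ⟨ε, hε, h⟩ := Metric.isOpen_iff.1 hcl.isOpen_compl x (by simp)
  refine ⟨min ε 1, lt_min hε one_pos, fun r hr hx => ?_⟩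
  rw [Set.disjoint_left]
  intro y hy hyr
  refine h (Metric.ball_subset_ball (min_le_left _ _) hy) (mem_iUnion₂.2 ⟨r, ⟨⟨hr, y, ?_, hyr⟩,
    hx⟩, hyr⟩)
  exact Metric.ball_subset_ball (min_le_right _ _) hy

lemma interior_biUnion_wall {A : Set (X ≃ᵢ X)} (hA : A.Finite) (h : ∀ r ∈ A, IsReflection r) :
    interior (⋃ r ∈ A, wall r) = ∅ := by
  induction A, hA using Set.Finite.induction_on with
  | empty => simp
  | @insert r A hr hA ih =>
    rw [biUnion_insert, interior_union_isClosed_of_interior_empty (isClosed_wall r)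
      (ih fun s hs => h s (mem_insert_of_mem _ hs))]
    exact (h r (mem_insert _ _)).2.1

lemma ActsProperly.exists_notMem_walls (hW : ActsProperly W) (x : X) {δ : ℝ} (hδ : 0 < δ) :
    ∃ y ∈ Metric.ball x δ, ∀ r ∈ reflectionsIn W, y ∉ wall r := by
  by_contra! hcon
  have h0 := interior_biUnion_wall (hW.finite_walls x δ) fun r hr => hr.1.2
  have : Metric.ball x δ ⊆ interior (⋃ r ∈ {r | r ∈ reflectionsIn W ∧
      (Metric.ball x δ ∩ wall r).Nonempty}, wall r) := by
    refine interior_maximal (fun y hy => ?_) Metric.isOpen_ball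
    obtain ⟨r, hr, hyr⟩ := hcon y hy
    exact mem_iUnion₂.2 ⟨r, ⟨hr, y, hy, hyr⟩, hyr⟩
  rw [h0] at this
  exact this (Metric.mem_ball_self hδ)

/-- The point of an orbit that is nearest to `x` is not separated from `x` by a generator. -/
lemma ActsProperly.exists_closure_forall_mem_halfSpace (hX : IsCATZero X) (hW : ActsProperly W)
    {A : Set (X ≃ᵢ X)} (hA : A ⊆ reflectionsIn W) {x y : X}
    (hx : ∀ r ∈ reflectionsIn W, x ∉ wall r) (hy : ∀ r ∈ reflectionsIn W, y ∉ wall r) :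
    ∃ u ∈ Subgroup.closure A, ∀ s ∈ A, u y ∈ halfSpace x s := by
  have hAW : Subgroup.closure A ≤ W := (Subgroup.closure_le _).2 fun r hr => (hA hr).1
  obtain ⟨u, hu, hmin⟩ := hW.exists_minimal_dist x y (A := Subgroup.closure A) hAW
    ⟨1, Subgroup.one_mem _⟩
  refine ⟨u, hu, fun s hs => ?_⟩
  by_contra hcon
  have hsep : Separates s x (u y) :=
    ⟨hx s (hA hs), notMem_wall_apply (hAW hu) hy s (hA hs), hcon⟩
  have h1 := hsep.dist_lt hX (hA hs).2
  have h2 := hmin (s * u) ((Subgroup.closure A).mul_mem (Subgroup.subset_closure hs) hu)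
  rw [IsometryEquiv.mul_apply] at h2
  exact absurd h1 (not_lt.2 h2)

/-- The point of a finite orbit that is farthest from `x` is separated from `x` by every
generator. -/
lemma exists_closure_forall_separates (hX : IsCATZero X) {A : Set (X ≃ᵢ X)}
    (hA : A ⊆ reflectionsIn W) (hfin : (Subgroup.closure A : Set (X ≃ᵢ X)).Finite) {x y : X}
    (hx : ∀ r ∈ reflectionsIn W, x ∉ wall r) (hy : ∀ r ∈ reflectionsIn W, y ∉ wall r) :
    ∃ u ∈ Subgroup.closure A, ∀ s ∈ A, Separates s x (u y) := by
  have hAW : Subgroup.closure A ≤ W := (Subgroup.closure_le _).2 fun r hr => (hA hr).1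
  obtain ⟨u, hu, hmax⟩ := hfin.exists_maximalFor (fun g => dist x (g y)) _
    ⟨1, Subgroup.one_mem _⟩
  refine ⟨u, hu, fun s hs => ?_⟩
  by_contra hcon
  have hu' := notMem_wall_apply (hAW hu) hy s (hA hs)
  have hsep := ((hA hs).2.separates_apply_iff (hx s (hA hs)) hu').2 hcon
  have h1 := hsep.dist_lt hX (hA hs).2
  rw [(hA hs).2.apply_apply] at h1
  have h2 := hmax ((Subgroup.closure A).mul_mem (Subgroup.subset_closure hs) hu) h1.le
  exact absurd h1 (not_lt.2 h2)

end ProperActions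

/-! ### The fundamental chamber, its faces and its translates -/

section Chambers

variable {X : Type*} [MetricSpace X]

/-- A chamber `C ∋ x₀` with its minimal defining set `S` of reflections, in a group of isometries
acting properly such that `C` has compact closure and trivial stabilizer. -/
structure IsFundamentalChamber (W : Subgroup (X ≃ᵢ X)) (x₀ : X) (C : Set X)
    (S : Set (X ≃ᵢ X)) : Prop where
  proper : ActsProperly W
  chamber : IsChamber W C
  base : x₀ ∈ C
  minimal : IsMinimalDefiningSet W x₀ C S
  isCompact : IsCompact (closure C)
  stab : ∀ g ∈ W, g '' C = C → g = 1

lemma IsChamber.eq_connectedComponentIn {W : Subgroup (X ≃ᵢ X)} {C : Set X}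
    (hC : IsChamber W C) {x : X} (hx : x ∈ C) :
    C = connectedComponentIn (⋃ r ∈ reflectionsIn W, wall r)ᶜ x := by
  obtain ⟨y, -, rfl⟩ := hC
  exact connectedComponentIn_eq hx

lemma IsChamber.notMem_wall {W : Subgroup (X ≃ᵢ X)} {C : Set X} (hC : IsChamber W C) {x : X}
    (hx : x ∈ C) : ∀ r ∈ reflectionsIn W, x ∉ wall r := by
  intro r hr h
  obtain ⟨y, -, rfl⟩ := hC
  exact connectedComponentIn_subset _ _ hx (mem_iUnion₂.2 ⟨r, hr, h⟩)

lemma IsChamber.mem_halfSpace {W : Subgroup (X ≃ᵢ X)} {C : Set X} (hC : IsChamber W C) {x y : X}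
    (hx : x ∈ C) (hy : y ∈ C) {r : X ≃ᵢ X} (hr : r ∈ reflectionsIn W) : y ∈ halfSpace x r := by
  have hpre : IsPreconnected C := by
    rw [hC.eq_connectedComponentIn hx]; exact isPreconnected_connectedComponentIn
  exact hpre.subset_connectedComponentIn hx (fun z hz => hC.notMem_wall hz r hr) hy

lemma biUnion_wall_image {W : Subgroup (X ≃ᵢ X)} {g : X ≃ᵢ X} (hg : g ∈ W) :
    g '' (⋃ r ∈ reflectionsIn W, wall r)ᶜ = (⋃ r ∈ reflectionsIn W, wall r)ᶜ := by
  have key : ∀ h ∈ W, ∀ y ∈ (⋃ r ∈ reflectionsIn W, wall r)ᶜ,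
      h y ∈ (⋃ r ∈ reflectionsIn W, wall r)ᶜ := by
    intro h hh y hy
    simp only [mem_compl_iff, mem_iUnion, not_exists] at hy ⊢
    exact notMem_wall_apply hh hy
  refine Subset.antisymm ?_ fun y hy => ⟨g⁻¹ y, key _ (W.inv_mem hg) y hy, by simp⟩
  rintro _ ⟨y, hy, rfl⟩
  exact key g hg y hy

lemma IsChamber.image {W : Subgroup (X ≃ᵢ X)} {C : Set X} (hC : IsChamber W C) {g : X ≃ᵢ X}
    (hg : g ∈ W) : IsChamber W (g '' C) := by
  obtain ⟨x, hx, rfl⟩ := hC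
  refine ⟨g x, ?_, ?_⟩
  · rw [← biUnion_wall_image hg]; exact mem_image_of_mem _ hx
  · rw [g.image_connectedComponentIn hx, biUnion_wall_image hg]

lemma IsChamber.eq_of_mem {W : Subgroup (X ≃ᵢ X)} {C D : Set X} (hC : IsChamber W C)
    (hD : IsChamber W D) {x : X} (hx : x ∈ C) (hx' : x ∈ D) : C = D := by
  rw [hC.eq_connectedComponentIn hx, hD.eq_connectedComponentIn hx']

/-- Compactness and trivial stabilizer are assumed for some chamber `D` only; the orbit point of `D`
nearest to `x₀` lies in `C`, so an element of `W` carries `D` to `C`. -/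
lemma IsFundamentalChamber.of_isCocompact (hX : IsCATZero X) {W : Subgroup (X ≃ᵢ X)}
    (hW : IsCocompactDiscreteReflectionGroup W) {C : Set X} (hC : IsChamber W C) {x₀ : X}
    (hx₀ : x₀ ∈ C) {S : Set (X ≃ᵢ X)} (hS : IsMinimalDefiningSet W x₀ C S) :
    IsFundamentalChamber W x₀ C S := by
  obtain ⟨-, hprop, D, hD, hcomp, hstab⟩ := hW
  obtain ⟨y, hy⟩ : D.Nonempty := by
    obtain ⟨y, hy, rfl⟩ := hD
    exact ⟨y, mem_connectedComponentIn hy⟩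
  obtain ⟨u, hu, hmem⟩ := hprop.exists_closure_forall_mem_halfSpace hX hS.1
    (hC.notMem_wall hx₀) (hD.notMem_wall hy)
  have huW : u ∈ W := (Subgroup.closure_le W).2 (fun r hr => (hS.1 hr).1) hu
  have huy : u y ∈ C := by rw [hS.2.1]; exact mem_iInter₂.2 hmem
  obtain rfl : u '' D = C := (hD.image huW).eq_of_mem hC (mem_image_of_mem _ hy) huy
  refine ⟨hprop, hC, hx₀, hS, ?_, fun g hg h => ?_⟩
  · have := u.toHomeomorph.image_closure D
    exact this ▸ hcomp.image u.continuous
  · have h1 : (u⁻¹ * g * u : X ≃ᵢ X) '' D = D := by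
      have : (u⁻¹ * g * u : X ≃ᵢ X) '' D = (u⁻¹ : X ≃ᵢ X) '' (g '' (u '' D)) := by
        simp only [image_image]; rfl
      rw [this, h, image_image]
      simp
    have h2 := hstab _ (W.mul_mem (W.mul_mem (W.inv_mem huW) hg) huW) h1
    have : g = u * (u⁻¹ * g * u) * u⁻¹ := by group
    rw [this, h2]; group

lemma apply_mem_ball {r : X ≃ᵢ X} {z y : X} {ε : ℝ} (hz : z ∈ wall r)
    (hy : y ∈ Metric.ball z ε) : r y ∈ Metric.ball z ε := by
  have hz' : r z = z := hz
  rw [Metric.mem_ball, ← hz', r.dist_eq]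
  exact hy

namespace IsFundamentalChamber

variable {W : Subgroup (X ≃ᵢ X)} {x₀ : X} {C : Set X} {S : Set (X ≃ᵢ X)}

lemma notMem_wall (h : IsFundamentalChamber W x₀ C S) {g : X ≃ᵢ X} (hg : g ∈ W) :
    ∀ r ∈ reflectionsIn W, g x₀ ∉ wall r :=
  notMem_wall_apply hg (h.chamber.notMem_wall h.base)

lemma base_notMem_wall (h : IsFundamentalChamber W x₀ C S) :
    ∀ r ∈ reflectionsIn W, x₀ ∉ wall r :=
  h.chamber.notMem_wall h.base

lemma closure_le (h : IsFundamentalChamber W x₀ C S) : Subgroup.closure S ≤ W :=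
  (Subgroup.closure_le W).2 fun _ hr => (h.minimal.1 hr).1

lemma mem_iff (h : IsFundamentalChamber W x₀ C S) {y : X} :
    y ∈ C ↔ ∀ s ∈ S, y ∈ halfSpace x₀ s := by
  conv_lhs => rw [h.minimal.2.1]
  exact mem_iInter₂

lemma eq_one_of_mem (h : IsFundamentalChamber W x₀ C S) {g : X ≃ᵢ X} (hg : g ∈ W) {y : X}
    (hy : y ∈ C) (hgy : g y ∈ C) : g = 1 :=
  h.stab g hg ((h.chamber.image hg).eq_of_mem h.chamber (mem_image_of_mem _ hy) hgy)

lemma exists_dist_le (h : IsFundamentalChamber W x₀ C S) :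
    ∃ D : ℝ, 0 ≤ D ∧ ∀ y ∈ C, dist x₀ y ≤ D := by
  obtain ⟨D, hD⟩ := (Metric.isBounded_iff_subset_closedBall x₀).1
    (h.isCompact.isBounded.subset subset_closure)
  have : ∀ y ∈ C, dist x₀ y ≤ D := fun y hy => by
    rw [dist_comm]; exact hD hy
  exact ⟨D, dist_nonneg.trans (this x₀ h.base), this⟩

/-- `S` generates `W`. -/
lemma closure_eq (hX : IsCATZero X) (h : IsFundamentalChamber W x₀ C S) :
    Subgroup.closure S = W := by
  refine le_antisymm h.closure_le fun v hv => ?_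
  obtain ⟨u, hu, hmem⟩ := h.proper.exists_closure_forall_mem_halfSpace hX h.minimal.1
    h.base_notMem_wall (h.notMem_wall hv)
  have := h.eq_one_of_mem (W.mul_mem (h.closure_le hu) hv) h.base (h.mem_iff.2 hmem)
  rw [← inv_eq_of_mul_eq_one_right this]
  exact (Subgroup.closure S).inv_mem hu

/-- The error `δ` allows `y` to be moved off all walls, after which a nearest orbit point lies in
`C`. -/
lemma exists_apply_mem (hX : IsCATZero X) (h : IsFundamentalChamber W x₀ C S) (y : X) {δ : ℝ}
    (hδ : 0 < δ) : ∃ g ∈ W, ∃ z ∈ C, dist y (g z) < δ := by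
  obtain ⟨y', hy', hw⟩ := h.proper.exists_notMem_walls y hδ
  obtain ⟨u, hu, hmem⟩ := h.proper.exists_closure_forall_mem_halfSpace hX h.minimal.1
    h.base_notMem_wall hw
  refine ⟨u⁻¹, W.inv_mem (h.closure_le hu), u y', h.mem_iff.2 hmem, ?_⟩
  rw [IsometryEquiv.inv_apply_self, dist_comm]
  exact hy'

/-- The orbit of the base point is coarsely dense. -/
lemma exists_dist_orbit_le (hX : IsCATZero X) (h : IsFundamentalChamber W x₀ C S) :
    ∃ D : ℝ, 0 ≤ D ∧ ∀ y, ∃ g ∈ W, dist (g x₀) y ≤ D := by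
  obtain ⟨D, hD, hC⟩ := h.exists_dist_le
  refine ⟨D + 1, by linarith, fun y => ?_⟩
  obtain ⟨g, hg, z, hz, hd⟩ := h.exists_apply_mem hX y one_pos
  refine ⟨g, hg, ?_⟩
  have h1 := dist_triangle (g x₀) (g z) y
  rw [g.dist_eq, dist_comm (g z)] at h1
  linarith [hC z hz]

/-- Finitely many translates of the compact set `closure C` cover a closed ball. -/
lemma properSpace (hX : IsCATZero X) (h : IsFundamentalChamber W x₀ C S) : ProperSpace X := by
  obtain ⟨D, hD, hC⟩ := h.exists_dist_le
  refine ⟨fun y ρ => ?_⟩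
  have hfin := h.proper.finite_setOf_dist_le x₀ y (ρ + 1 + D)
  have hK : IsCompact (⋃ g ∈ {g | g ∈ W ∧ dist (g x₀) y ≤ ρ + 1 + D}, g '' closure C) :=
    hfin.isCompact_biUnion fun g _ => h.isCompact.image g.continuous
  refine hK.of_isClosed_subset Metric.isClosed_closedBall fun z hz => ?_
  rw [← hK.isClosed.closure_eq, Metric.mem_closure_iff]
  intro ε hε
  obtain ⟨g, hg, c, hc, hd⟩ := h.exists_apply_mem hX z (lt_min hε one_pos)
  refine ⟨g c, mem_iUnion₂.2 ⟨g, ⟨hg, ?_⟩, mem_image_of_mem _ (subset_closure hc)⟩,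
    hd.trans_le (min_le_left _ _)⟩
  have h1 := dist_triangle4 (g x₀) (g c) z y
  rw [g.dist_eq, dist_comm (g c)] at h1
  rw [Metric.mem_closedBall] at hz
  linarith [hC c hc, min_le_right ε 1]

/-- Every wall of `S` has a point that lies on no other wall of `S` and is a limit of points of
the chamber. -/
lemma exists_face (hX : IsCATZero X) (h : IsFundamentalChamber W x₀ C S) {t : X ≃ᵢ X}
    (ht : t ∈ S) : ∃ z ∈ wall t, (∀ s ∈ S, s ≠ t → z ∈ halfSpace x₀ s) ∧ ∃ ε > 0,
      (∀ r ∈ reflectionsIn W, z ∉ wall r → Disjoint (Metric.ball z ε) (wall r)) ∧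
      Metric.ball z ε ∩ halfSpace x₀ t ⊆ C := by
  have hxs : ∀ s ∈ S, x₀ ∉ wall s := fun s hs => h.base_notMem_wall s (h.minimal.1 hs)
  obtain ⟨z, hzt, hz⟩ : ∃ z ∈ wall t, ∀ s ∈ S, s ≠ t → z ∈ halfSpace x₀ s := by
    -- Minimality of `S` gives a point violating only the condition at `t`; the segment to it from
    -- `x₀` crosses the wall of `t` inside the other half-spaces, by convexity.
    obtain ⟨y, hy, hyC⟩ : ∃ y, y ∈ (⋂ s ∈ S \ {t}, halfSpace x₀ s) ∧ y ∉ C := by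
      by_contra! hcon
      refine h.minimal.2.2 t ht (Subset.antisymm (fun y hy => ?_) hcon)
      exact mem_iInter₂.2 fun s hs => h.mem_iff.1 hy s hs.1
    rw [mem_iInter₂] at hy
    have hyt : y ∉ halfSpace x₀ t := fun hyt => hyC <| h.mem_iff.2 fun s hs => by
      by_cases hst : s = t
      · rwa [hst]
      · exact hy s ⟨hs, hst⟩
    by_cases hyw : y ∈ wall t
    · exact ⟨y, hyw, fun s hs hst => hy s ⟨hs, hst⟩⟩
    · obtain ⟨c, hc⟩ := hX.1 x₀ y
      have hsep : Separates t x₀ y := ⟨hxs t ht, hyw, hyt⟩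
      obtain ⟨a, ha, haw⟩ := hsep.exists_mem_wall hc
      exact ⟨c a, haw, fun s hs hst => (h.minimal.1 hs).2.convex_halfSpace (hxs s hs) _
        (mem_halfSpace_self (hxs s hs)) _ (hy s ⟨hs, hst⟩) c hc a ha⟩
  obtain ⟨ε, hε, hdis⟩ := h.proper.exists_ball_disjoint_walls z
  refine ⟨z, hzt, hz, ε, hε, hdis, fun y hy => h.mem_iff.2 fun s hs => ?_⟩
  by_cases hst : s = t
  · rw [hst]; exact hy.2
  · exact hX.ball_subset_halfSpace (hdis s (h.minimal.1 hs) (halfSpace_subset _ _ (hz s hs hst)))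
      (hz s hs hst) hy.1

/-- The chamber has points arbitrarily close to its faces. -/
lemma exists_mem_ball (h : IsFundamentalChamber W x₀ C S) {t : X ≃ᵢ X}
    (ht : t ∈ S) {z : X} (hz : z ∈ wall t) {ε : ℝ} (hε : 0 < ε)
    (hC : Metric.ball z ε ∩ halfSpace x₀ t ⊆ C) {δ : ℝ} (hδ : 0 < δ) :
    ∃ y ∈ Metric.ball z ε ∩ Metric.ball z δ, y ∈ C := by
  have htR := h.minimal.1 ht
  obtain ⟨y, hy, hyw⟩ : ∃ y ∈ Metric.ball z (min ε δ), y ∉ wall t := by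
    by_contra! hcon
    have := interior_maximal hcon Metric.isOpen_ball
    rw [htR.2.2.1] at this
    exact this (Metric.mem_ball_self (lt_min hε hδ))
  have hball : Metric.ball z (min ε δ) ⊆ Metric.ball z ε ∩ Metric.ball z δ :=
    subset_inter (Metric.ball_subset_ball (min_le_left _ _))
      (Metric.ball_subset_ball (min_le_right _ _))
  by_cases hyt : y ∈ halfSpace x₀ t
  · exact ⟨y, hball hy, hC ⟨(hball hy).1, hyt⟩⟩
  · have hty := hball (apply_mem_ball hz hy)
    exact ⟨t y, hty, hC ⟨hty.1, (htR.2.apply_mem_halfSpace_iff (h.base_notMem_wall t htR) hyw).2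
      hyt⟩⟩

/-- Only the wall of `t ∈ S` separates the chamber from its neighbour across `t`. -/
lemma eq_of_separates (hX : IsCATZero X) (h : IsFundamentalChamber W x₀ C S) {t r : X ≃ᵢ X}
    (ht : t ∈ S) (hr : r ∈ reflectionsIn W) (hsep : Separates r x₀ (t x₀)) : r = t := by
  have htR := h.minimal.1 ht
  have hx₀ := h.base_notMem_wall
  obtain ⟨z, hzt, -, ε, hε, hdis, hsub⟩ := h.exists_face hX ht
  obtain ⟨y, hy, hyC⟩ := h.exists_mem_ball ht hzt hε hsub hε
  -- If `z` is on the wall of `r`, both `r` and `t` preserve the ball, so for suitable `b ∈ C`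
  -- either `r b` or `t (r b)` is again in `C`. Otherwise the ball lies on one side of `r` and joins
  -- `C` to `t C`.
  by_cases hzr : z ∈ wall r
  · have hne : ¬ (r '' (Metric.ball z ε ∩ halfSpace x₀ t) ⊆ wall t) := by
      intro hcon
      have hopen : IsOpen (r '' (Metric.ball z ε ∩ halfSpace x₀ t)) :=
        r.toHomeomorph.isOpenMap _ (Metric.isOpen_ball.inter (hX.isOpen_halfSpace _ _))
      have := interior_maximal hcon hopen
      rw [htR.2.2.1] at this
      exact this (mem_image_of_mem r ⟨hy.1, h.mem_iff.1 hyC t ht⟩)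
    obtain ⟨_, ⟨b, hb, rfl⟩, hbt⟩ := not_subset.1 hne
    have hrb := apply_mem_ball hzr hb.1
    by_cases hside : r b ∈ halfSpace x₀ t
    · have := h.eq_one_of_mem hr.1 (hsub hb) (hsub ⟨hrb, hside⟩)
      subst this
      exact absurd rfl (h.base_notMem_wall _ hr)
    · have h1 := (htR.2.apply_mem_halfSpace_iff (hx₀ t htR) hbt).2 hside
      have h3 : t (r b) ∈ C := hsub ⟨apply_mem_ball hzt hrb, h1⟩
      have h2 := h.eq_one_of_mem (W.mul_mem htR.1 hr.1) (hsub hb) h3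
      rw [← htR.2.inv_eq]
      exact (inv_eq_of_mul_eq_one_right h2).symm
  · exfalso
    have hball := hdis r hr hzr
    have hyr := h.chamber.notMem_wall hyC
    have h1 := hsep.or (hyr r hr)
    have h2 : ¬ Separates r x₀ y := (not_separates_iff (hx₀ r hr) (hyr r hr)).2
      (h.chamber.mem_halfSpace h.base hyC hr)
    have hty := notMem_wall_apply htR.1 hyr
    rcases (h1.resolve_left h2).or (hty r hr) with h3 | h3
    · refine h3.2.2 ?_
      have := hX.ball_subset_halfSpace (ε := ε) (r := r) (x := z) (y := z) hball
        (mem_halfSpace_self hzr)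
      rw [← halfSpace_eq (this hy.1)]
      exact this (apply_mem_ball hzt hy.1)
    · refine h3.symm.2.2 ?_
      exact (h.chamber.image htR.1).mem_halfSpace (mem_image_of_mem _ h.base)
        (mem_image_of_mem _ hyC) hr

/-- A point of `C` within distance 1 of a face moves by less than 2 under `t`. Uniformity in `t`
makes displacement linear in word length without finiteness of `S`. -/
lemma exists_dist_apply_le (hX : IsCATZero X) (h : IsFundamentalChamber W x₀ C S) :
    ∃ M : ℝ, 0 ≤ M ∧ ∀ t ∈ S, dist x₀ (t x₀) ≤ M := by
  obtain ⟨D, hD, hC⟩ := h.exists_dist_le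
  refine ⟨2 * D + 2, by linarith, fun t ht => ?_⟩
  obtain ⟨z, hzt, -, ε, hε, -, hsub⟩ := h.exists_face hX ht
  obtain ⟨y, ⟨-, hy⟩, hyC⟩ := h.exists_mem_ball ht hzt hε hsub one_pos
  have hz := apply_mem_ball hzt hy
  rw [Metric.mem_ball] at hy hz
  have h1 := dist_triangle4 x₀ y (t y) (t x₀)
  have h2 := dist_triangle y z (t y)
  rw [dist_comm z] at h2
  rw [t.dist_eq, dist_comm y x₀] at h1
  linarith [hC y hyC]

end IsFundamentalChamber

end Chambers

/-! ### Word length, exchange and descents -/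

section Words

variable {X : Type*} [MetricSpace X]

/-- The least length of a word in `A` with product `v`. -/
noncomputable def wordLength {G : Type*} [Monoid G] (A : Set G) (v : G) : ℕ :=
  sInf {n | ∃ L : List G, (∀ t ∈ L, t ∈ A) ∧ L.prod = v ∧ L.length = n}

lemma wordLength_prod_le {G : Type*} [Monoid G] {A : Set G} {L : List G} (hL : ∀ t ∈ L, t ∈ A) :
    wordLength A L.prod ≤ L.length :=
  Nat.sInf_le ⟨L, hL, rfl, rfl⟩

lemma exists_word {A : Set (X ≃ᵢ X)} (hA : ∀ t ∈ A, IsReflection t) {v : X ≃ᵢ X}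
    (hv : v ∈ Subgroup.closure A) :
    ∃ L : List (X ≃ᵢ X), (∀ t ∈ L, t ∈ A) ∧ L.prod = v ∧ L.length = wordLength A v := by
  have hne : {n | ∃ L : List (X ≃ᵢ X), (∀ t ∈ L, t ∈ A) ∧ L.prod = v ∧ L.length = n}.Nonempty := by
    rw [← Subgroup.mem_toSubmonoid, Subgroup.closure_toSubmonoid] at hv
    obtain ⟨L, hL, hprod⟩ := Submonoid.exists_list_of_mem_closure hv
    refine ⟨_, L, fun t ht => ?_, hprod, rfl⟩
    rcases hL t ht with h | h
    · exact h
    · rw [Set.mem_inv] at h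
      rwa [← inv_inv t, (hA _ h).inv_eq]
  exact Nat.sInf_mem hne

lemma wordLength_mul_le {A : Set (X ≃ᵢ X)} (hA : ∀ t ∈ A, IsReflection t) {t v : X ≃ᵢ X}
    (ht : t ∈ A) (hv : v ∈ Subgroup.closure A) :
    wordLength A (t * v) ≤ wordLength A v + 1 := by
  obtain ⟨L, hL, rfl, hlen⟩ := exists_word hA hv
  have := wordLength_prod_le (A := A) (L := t :: L) (by simpa [ht] using hL)
  rw [List.prod_cons, List.length_cons] at this
  omega

lemma prod_eq_of_exchange {L₁ L₂ : List (X ≃ᵢ X)} {s t : X ≃ᵢ X} (ht : IsReflection t)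
    (e : s * L₁.prod = L₁.prod * t) : s * (L₁ ++ t :: L₂).prod = (L₁ ++ L₂).prod := by
  rw [List.prod_append, List.prod_cons, ← mul_assoc, e, mul_assoc, ht.mul_mul_cancel,
    List.prod_append]

namespace IsFundamentalChamber

variable {W : Subgroup (X ≃ᵢ X)} {x₀ : X} {C : Set X} {S : Set (X ≃ᵢ X)}

lemma isReflection (h : IsFundamentalChamber W x₀ C S) : ∀ s ∈ S, IsReflection s :=
  fun _ hs => (h.minimal.1 hs).2

/-- The exchange condition. -/
lemma exchange (hX : IsCATZero X) (h : IsFundamentalChamber W x₀ C S) {L : List (X ≃ᵢ X)}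
    (hL : ∀ t ∈ L, t ∈ S) {s : X ≃ᵢ X} (hs : s ∈ reflectionsIn W)
    (hsep : Separates s x₀ (L.prod x₀)) :
    ∃ L₁ t L₂, L = L₁ ++ t :: L₂ ∧ s * L₁.prod = L₁.prod * t := by
  induction L generalizing s with
  | nil =>
    exact absurd (mem_halfSpace_self hsep.1) hsep.2.2
  | cons t L ih =>
    have ht : t ∈ S := hL t List.mem_cons_self
    have hL' : ∀ u ∈ L, u ∈ S := fun u hu => hL u (List.mem_cons_of_mem _ hu)
    have htr := h.minimal.1 ht
    -- The wall of `s` is crossed either at the first step of the gallery, where it must be that of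
    -- `t`, or later. Conjugation by `t` leads out of `S`, so the induction runs over all
    -- reflections in `W`.
    rcases hsep.or (h.notMem_wall htr.1 s hs) with h1 | h1
    · obtain rfl := h.eq_of_separates hX ht hs h1
      exact ⟨[], s, L, rfl, by simp⟩
    · have h2 := h1.conj t⁻¹
      rw [List.prod_cons, IsometryEquiv.mul_apply, IsometryEquiv.inv_apply_self,
        IsometryEquiv.inv_apply_self] at h2
      obtain ⟨L₁, u, L₂, rfl, e⟩ := ih hL' (reflectionsIn_conj (W.inv_mem htr.1) hs) h2
      refine ⟨t :: L₁, u, L₂, rfl, ?_⟩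
      rw [List.prod_cons, mul_assoc t, ← e]
      group

variable {A : Set (X ≃ᵢ X)}

/-- Exchange deletes a letter from a word, so a shortest word in `A` stays a word in `A`: the count
works inside each parabolic subgroup. -/
lemma wordLength_lt_of_separates (hX : IsCATZero X) (h : IsFundamentalChamber W x₀ C S)
    (hA : A ⊆ S) {v : X ≃ᵢ X} (hv : v ∈ Subgroup.closure A) {s : X ≃ᵢ X} (hs : s ∈ A)
    (hsep : Separates s x₀ (v x₀)) : wordLength A (s * v) + 1 = wordLength A v := by
  have hAr : ∀ t ∈ A, IsReflection t := fun t ht => h.isReflection t (hA ht)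
  obtain ⟨L, hL, rfl, hlen⟩ := exists_word hAr hv
  obtain ⟨L₁, t, L₂, rfl, e⟩ := h.exchange hX (fun t ht => hA (hL t ht)) (h.minimal.1 (hA hs)) hsep
  have ht : t ∈ A := hL t (by simp)
  have h1 := wordLength_mul_le hAr hs ((Subgroup.closure A).mul_mem (Subgroup.subset_closure hs) hv)
  rw [(hAr s hs).mul_mul_cancel] at h1
  rw [prod_eq_of_exchange (hAr t ht) e] at h1 ⊢
  have h2 := wordLength_prod_le (A := A) (L := L₁ ++ L₂) (fun u hu => hL u (by
    simp only [List.mem_append, List.mem_cons] at hu ⊢; tauto))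
  simp only [List.length_append, List.length_cons] at hlen h2
  omega

lemma separates_iff_wordLength_lt (hX : IsCATZero X) (h : IsFundamentalChamber W x₀ C S)
    (hA : A ⊆ S) {v : X ≃ᵢ X} (hv : v ∈ Subgroup.closure A) {s : X ≃ᵢ X} (hs : s ∈ A) :
    Separates s x₀ (v x₀) ↔ wordLength A (s * v) < wordLength A v := by
  refine ⟨fun hsep => ?_, fun hlt => ?_⟩
  · have := h.wordLength_lt_of_separates hX hA hv hs hsep
    omega
  · by_contra hcon
    have hsR := h.minimal.1 (hA hs)
    have hvW : v ∈ W := h.closure_le (Subgroup.closure_mono hA hv)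
    have h1 := (hsR.2.separates_apply_iff (h.base_notMem_wall s hsR)
      (h.notMem_wall hvW s hsR)).2 hcon
    have := h.wordLength_lt_of_separates hX hA
      ((Subgroup.closure A).mul_mem (Subgroup.subset_closure hs) hv) hs h1
    rw [hsR.2.mul_mul_cancel] at this
    omega

/-- A nontrivial element of a parabolic subgroup moves the chamber across one of the walls of its
generators. -/
lemma exists_separates (hX : IsCATZero X) (h : IsFundamentalChamber W x₀ C S)
    (hA : A ⊆ S) {v : X ≃ᵢ X} (hv : v ∈ Subgroup.closure A) (hv1 : v ≠ 1) :
    ∃ t ∈ A, Separates t x₀ (v x₀) := by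
  have hAr : ∀ t ∈ A, IsReflection t := fun t ht => h.isReflection t (hA ht)
  obtain ⟨L, hL, hprod, hlen⟩ := exists_word hAr hv
  cases L with
  | nil => exact absurd hprod.symm hv1
  | cons t L =>
    have ht : t ∈ A := hL t List.mem_cons_self
    refine ⟨t, ht, (h.separates_iff_wordLength_lt hX hA hv ht).2 ?_⟩
    rw [← hlen, ← hprod, List.prod_cons, (hAr t ht).mul_mul_cancel]
    have := wordLength_prod_le (A := A) (L := L) fun u hu => hL u (List.mem_cons_of_mem _ hu)
    simp only [List.length_cons]
    omega

/-- Exchange would put `s` into the subgroup generated by `A`; then some wall of `A` separates `x₀`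
from `s x₀`, and only the wall of `s` does. -/
lemma not_separates_of_mem_closure (hX : IsCATZero X) (h : IsFundamentalChamber W x₀ C S)
    (hA : A ⊆ S) {v : X ≃ᵢ X} (hv : v ∈ Subgroup.closure A) {s : X ≃ᵢ X} (hs : s ∈ S)
    (hsA : s ∉ A) : ¬ Separates s x₀ (v x₀) := by
  intro hsep
  have hAr : ∀ t ∈ A, IsReflection t := fun t ht => h.isReflection t (hA ht)
  obtain ⟨L, hL, rfl, -⟩ := exists_word hAr hv
  obtain ⟨L₁, t, L₂, rfl, e⟩ := h.exchange hX (fun t ht => hA (hL t ht)) (h.minimal.1 hs) hsep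
  have h1 : L₁.prod ∈ Subgroup.closure A :=
    (Subgroup.closure A).list_prod_mem fun u hu => Subgroup.subset_closure (hL u (by simp [hu]))
  have h2 : s ∈ Subgroup.closure A := by
    rw [eq_mul_inv_of_mul_eq e]
    exact mul_mem (mul_mem h1 (Subgroup.subset_closure (hL t (by simp)))) (inv_mem h1)
  have hs1 : s ≠ 1 := by
    rintro rfl
    exact h.base_notMem_wall 1 (h.minimal.1 hs) rfl
  obtain ⟨u, hu, hsep'⟩ := h.exists_separates hX hA h2 hs1
  exact hsA (h.eq_of_separates hX hs (h.minimal.1 (hA hu)) hsep' ▸ hu)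

/-- If all generators of a parabolic subgroup separate the chamber from `v x₀`, then every element
of the parabolic subgroup is an initial segment of `v`. -/
lemma wordLength_add_le (hX : IsCATZero X) (h : IsFundamentalChamber W x₀ C S)
    (hA : A ⊆ S) {v : X ≃ᵢ X} (hv : v ∈ Subgroup.closure S)
    (hsep : ∀ t ∈ A, Separates t x₀ (v x₀)) (n : ℕ) :
    ∀ b ∈ Subgroup.closure A, wordLength A b = n →
      wordLength S (b⁻¹ * v) + n ≤ wordLength S v := by
  have hSr := h.isReflection
  have hAr : ∀ t ∈ A, IsReflection t := fun t ht => hSr t (hA ht)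
  induction n with
  | zero =>
    intro b hb hb0
    obtain ⟨L, -, hprod, hlen⟩ := exists_word hAr hb
    rw [hb0, List.length_eq_zero_iff] at hlen
    subst hlen
    rw [← hprod]; simp
  | succ n ih =>
    intro b hb hbn
    obtain ⟨L, hL, hprod, hlen⟩ := exists_word hAr hb
    obtain ⟨t, M, rfl⟩ : ∃ t M, L = t :: M := by
      cases L with
      | nil => simp [hbn] at hlen
      | cons t M => exact ⟨t, M, rfl⟩
    have ht : t ∈ A := hL t List.mem_cons_self
    have hM : ∀ u ∈ M, u ∈ A := fun u hu => hL u (List.mem_cons_of_mem _ hu)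
    have hMc : M.prod ∈ Subgroup.closure A :=
      (Subgroup.closure A).list_prod_mem fun u hu => Subgroup.subset_closure (hM u hu)
    rw [List.prod_cons] at hprod
    rw [List.length_cons, hbn, Nat.add_right_cancel_iff] at hlen
    have hMn : wordLength A M.prod = n := by
      have h1 := wordLength_prod_le (A := A) hM
      have h2 := wordLength_mul_le hAr ht hMc
      rw [hprod] at h2
      omega
    have hIH := ih _ hMc hMn
    obtain ⟨N, hN, hNprod, hNlen⟩ := exists_word hSr (mul_mem
      (inv_mem (Subgroup.closure_mono hA hMc)) hv)
    have hMN : (M ++ N).prod = v := by rw [List.prod_append, hNprod]; group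
    have hsep' := hsep t ht
    rw [← hMN] at hsep'
    obtain ⟨L₁, u, L₂, hL₁, e⟩ := h.exchange hX (L := M ++ N) (fun u hu => by
      rcases List.mem_append.1 hu with hu | hu
      · exact hA (hM u hu)
      · exact hN u hu) (h.minimal.1 (hA ht)) hsep'
    -- A letter deleted from `N` shortens the word for `b⁻¹ * v`, as wanted; one deleted from `M`
    -- would shorten the minimal word for `b`.
    rcases List.append_eq_append_iff.1 hL₁ with ⟨Q, rfl, rfl⟩ | ⟨Q, rfl, hQ⟩
    · have hu : u ∈ S := hN u (by simp)
      have htv := prod_eq_of_exchange (L₂ := L₂) (hSr u hu) e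
      rw [← hL₁, hMN, List.append_assoc, List.prod_append] at htv
      have e2 : b⁻¹ * v = (Q ++ L₂).prod := by
        rw [← hprod, mul_inv_rev, (hAr t ht).inv_eq, mul_assoc, htv]; group
      have h2 := wordLength_prod_le (A := S) (L := Q ++ L₂) (fun w hw => hN w (by
        simp only [List.mem_append, List.mem_cons] at hw ⊢; tauto))
      rw [e2]
      simp only [List.length_append, List.length_cons] at h2 hNlen
      omega
    · cases Q with
      | nil =>
        simp only [List.nil_append] at hQ
        subst hQ
        have hu : u ∈ S := hN u (by simp)
        have htv := prod_eq_of_exchange (L₂ := L₂) (hSr u hu) e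
        simp only [List.append_nil] at hL₁ hMN hIH hNprod hprod hNlen
        rw [hMN, List.prod_append] at htv
        have e2 : b⁻¹ * v = L₂.prod := by
          rw [← hprod, mul_inv_rev, (hAr t ht).inv_eq, mul_assoc, htv]; group
        have h2 := wordLength_prod_le (A := S) (L := L₂) (fun w hw => hN w (by simp [hw]))
        rw [e2]
        simp only [List.length_cons] at hNlen
        omega
      | cons u' Q =>
        simp only [List.cons_append, List.cons.injEq] at hQ
        obtain ⟨rfl, rfl⟩ := hQ
        exfalso
        have hu : u ∈ A := hM u (by simp)
        have htv := prod_eq_of_exchange (L₂ := Q) (hAr u hu) e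
        rw [hprod] at htv
        have h2 := wordLength_prod_le (A := A) (L := L₁ ++ Q) (fun w hw => hM w (by
          simp only [List.mem_append, List.mem_cons] at hw ⊢; tauto))
        rw [← htv, hbn] at h2
        simp only [List.length_append, List.length_cons] at hlen h2
        omega

/-- If all walls of `A` separate the chamber from some `v x₀`, then `A` is spherical. -/
lemma finite_closure_of_separates (hX : IsCATZero X) (h : IsFundamentalChamber W x₀ C S)
    (hA : A ⊆ S) {v : X ≃ᵢ X} (hv : v ∈ W) (hsep : ∀ t ∈ A, Separates t x₀ (v x₀)) :
    (Subgroup.closure A : Set (X ≃ᵢ X)).Finite := by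
  obtain ⟨M, hM0, hM⟩ := h.exists_dist_apply_le hX
  have hlist : ∀ L : List (X ≃ᵢ X), (∀ t ∈ L, t ∈ S) → dist (L.prod x₀) x₀ ≤ L.length * M := by
    intro L hL
    induction L with
    | nil => simp
    | cons t L ih =>
      have h1 := ih fun u hu => hL u (List.mem_cons_of_mem _ hu)
      have h2 := hM t (hL t List.mem_cons_self)
      have h3 := dist_triangle (t (L.prod x₀)) (t x₀) x₀
      rw [t.dist_eq, dist_comm (t x₀)] at h3
      rw [List.prod_cons, IsometryEquiv.mul_apply, List.length_cons]
      push_cast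
      linarith
  rw [← h.closure_eq hX] at hv
  -- Elements of the parabolic subgroup are initial segments of `v`, hence no longer than `v`, so
  -- they move `x₀` a bounded distance.
  refine (h.proper.finite_setOf_dist_le x₀ x₀ (wordLength S v * M)).subset fun b hb => ?_
  refine ⟨h.closure_le (Subgroup.closure_mono hA hb), ?_⟩
  obtain ⟨L, hL, hprod, hlen⟩ := exists_word (fun t ht => h.isReflection t (hA ht)) hb
  have h1 := h.wordLength_add_le hX hA hv hsep _ b hb rfl
  have h2 : (L.length : ℝ) ≤ wordLength S v := by
    rw [hlen]; exact_mod_cast (Nat.le_add_left _ _).trans h1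
  rw [← hprod]
  exact (hlist L fun t ht => hA (hL t ht)).trans (mul_le_mul_of_nonneg_right h2 hM0)

/-- In a reduced word of `v` starting with `s`, exchange for `t` cannot delete that `s`, as `s ≠ t`;
it deletes a later letter, leaving a reduced word that starts with `t, s`. -/
lemma separates_mul_of_separates (hX : IsCATZero X) (h : IsFundamentalChamber W x₀ C S)
    {s t v : X ≃ᵢ X} (hs : s ∈ S) (ht : t ∈ S) (hst : s ≠ t) (hv : v ∈ W)
    (h1 : Separates s x₀ (v x₀)) (h2 : Separates t x₀ (v x₀)) :
    ∃ M : List (X ≃ᵢ X), (∀ u ∈ M, u ∈ S) ∧ v = t * (s * M.prod) ∧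
      M.length + 2 = wordLength S v := by
  have hSr := h.isReflection
  have hvS : v ∈ Subgroup.closure S := h.closure_eq hX ▸ hv
  obtain ⟨L, hL, hprod, hlen⟩ := exists_word hSr (mul_mem (Subgroup.subset_closure hs) hvS)
  have hl := h.wordLength_lt_of_separates hX subset_rfl hvS hs h1
  have hv' : (s :: L).prod = v := by rw [List.prod_cons, hprod, (hSr s hs).mul_mul_cancel]
  rw [← hv'] at h2
  obtain ⟨L₁, u, L₂, hL₁, e⟩ := h.exchange hX (L := s :: L) (by simpa [hs] using hL)
    (h.minimal.1 ht) h2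
  cases L₁ with
  | nil =>
    simp only [List.nil_append, List.cons.injEq] at hL₁
    obtain ⟨rfl, rfl⟩ := hL₁
    simp only [List.prod_nil, mul_one, one_mul] at e
    exact absurd e.symm hst
  | cons s' L₁ =>
    simp only [List.cons_append, List.cons.injEq] at hL₁
    obtain ⟨rfl, rfl⟩ := hL₁
    have htv := prod_eq_of_exchange (L₂ := L₂) (hSr u (hL u (by simp))) e
    rw [List.cons_append, hv'] at htv
    refine ⟨L₁ ++ L₂, fun w hw => hL w (by
        simp only [List.mem_append, List.mem_cons] at hw ⊢; tauto), ?_, ?_⟩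
    · rw [← (hSr t ht).mul_mul_cancel v, htv, List.cons_append, List.prod_cons]
    · simp only [List.length_append, List.length_cons] at hlen ⊢
      omega

/-- If `s` and `t` are distinct left descents of `v`, then `s` is a left descent of `t v`. -/
lemma separates_apply_of_separates (hX : IsCATZero X) (h : IsFundamentalChamber W x₀ C S)
    {s t v : X ≃ᵢ X} (hs : s ∈ S) (ht : t ∈ S) (hst : s ≠ t) (hv : v ∈ W)
    (h1 : Separates s x₀ (v x₀)) (h2 : Separates t x₀ (v x₀)) :
    Separates s x₀ (t (v x₀)) := by
  have hSr := h.isReflection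
  obtain ⟨M, hM, rfl, hlen⟩ := h.separates_mul_of_separates hX hs ht hst hv h1 h2
  have hvS : t * (s * M.prod) ∈ Subgroup.closure S := h.closure_eq hX ▸ hv
  have hl := h.wordLength_lt_of_separates hX subset_rfl hvS ht h2
  have htv := mul_mem (Subgroup.subset_closure ht) hvS
  have := (h.separates_iff_wordLength_lt hX subset_rfl htv hs).2 (by
    have := wordLength_prod_le (A := S) hM
    rw [(hSr t ht).mul_mul_cancel] at hl ⊢
    rw [(hSr s hs).mul_mul_cancel]
    omega)
  exact this

/-- If `s` and `t` are left descents of `v` and do not commute, then `s` is a left descent of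
`t s v`. -/
lemma separates_apply_apply_of_separates (hX : IsCATZero X) (h : IsFundamentalChamber W x₀ C S)
    {s t v : X ≃ᵢ X} (hs : s ∈ S) (ht : t ∈ S) (hst : s ≠ t) (hst2 : (s * t) ^ 2 ≠ 1)
    (hv : v ∈ W) (h1 : Separates s x₀ (v x₀)) (h2 : Separates t x₀ (v x₀)) :
    Separates s x₀ (t (s (v x₀))) := by
  have hSr := h.isReflection
  have hvS : v ∈ Subgroup.closure S := h.closure_eq hX ▸ hv
  obtain ⟨M, hM, hvM, hlen⟩ := h.separates_mul_of_separates hX hs ht hst hv h1 h2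
  have hv' : (t :: s :: M).prod = v := by rw [List.prod_cons, List.prod_cons, hvM]
  have h1' := h1
  rw [← hv'] at h1'
  obtain ⟨L₁, u, L₂, hL₁, e⟩ := h.exchange hX (L := t :: s :: M) (by simpa [hs, ht] using hM)
    (h.minimal.1 hs) h1'
  have hl := h.wordLength_lt_of_separates hX subset_rfl hvS hs h1
  -- Deleting `t` would give `s = t`, deleting `s` would make them commute; so the deleted letter is
  -- in `M`, and `t * (s * v)` has a word starting with `s`.
  rcases L₁ with _ | ⟨a, _ | ⟨b, L₁⟩⟩
  · simp only [List.nil_append, List.cons.injEq] at hL₁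
    obtain ⟨rfl, rfl⟩ := hL₁
    simp only [List.prod_nil, mul_one, one_mul] at e
    exact absurd e hst
  · simp only [List.cons_append, List.nil_append, List.cons.injEq] at hL₁
    obtain ⟨rfl, rfl, rfl⟩ := hL₁
    simp only [List.prod_cons, List.prod_nil, mul_one] at e
    refine absurd ?_ hst2
    rw [pow_two]
    nth_rewrite 2 [e]
    rw [mul_assoc, (hSr t ht).mul_mul_cancel, (hSr s hs).mul_self]
  · simp only [List.cons_append, List.cons.injEq] at hL₁
    obtain ⟨rfl, rfl, rfl⟩ := hL₁
    have hsv := prod_eq_of_exchange (L₂ := L₂) (hSr u (hM u (by simp))) e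
    simp only [List.cons_append] at hsv
    rw [hv', List.prod_cons, List.prod_cons] at hsv
    have hw : t * (s * v) = s * (L₁ ++ L₂).prod := by rw [hsv, (hSr t ht).mul_mul_cancel]
    have hmem : t * (s * v) ∈ Subgroup.closure S :=
      mul_mem (Subgroup.subset_closure ht) (mul_mem (Subgroup.subset_closure hs) hvS)
    have := (h.separates_iff_wordLength_lt hX subset_rfl hmem hs).2 (by
      have h3 := wordLength_prod_le (A := S) (L := L₁ ++ L₂) (fun w hw => hM w (by
        simp only [List.mem_append, List.mem_cons] at hw ⊢; tauto))
      have h4 := wordLength_mul_le hSr ht (mul_mem (Subgroup.subset_closure ht)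
        (mul_mem (Subgroup.subset_closure hs) hvS))
      rw [(hSr t ht).mul_mul_cancel] at h4
      rw [hw, (hSr s hs).mul_mul_cancel, ← hw]
      simp only [List.length_append, List.length_cons] at h3 hlen
      omega)
    exact this

end IsFundamentalChamber

end Words

/-! ### Axes, disjoint walls, and rays through the chamber -/

section Dynamics

variable {X : Type*} [MetricSpace X] {W : Subgroup (X ≃ᵢ X)}

lemma ActsProperly.apply_ne_of_orderOf_eq_zero (hW : ActsProperly W) {g : X ≃ᵢ X} (hg : g ∈ W)
    (h0 : orderOf g = 0) (x : X) : g x ≠ x := by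
  intro hx
  have hpow : ∀ n : ℕ, (g ^ n) x = x := fun n => by
    induction n with
    | zero => rfl
    | succ n ih => rw [pow_succ, IsometryEquiv.mul_apply, hx, ih]
  have hinj := injective_pow_iff_not_isOfFinOrder.2 (orderOf_eq_zero_iff.1 h0)
  refine Set.infinite_range_of_injective hinj ((hW x 1 one_pos).subset ?_)
  rintro _ ⟨n, rfl⟩
  exact ⟨W.pow_mem hg n, by rw [hpow]; exact Metric.mem_ball_self one_pos⟩

/-- The wall of `t` is convex, so were it to have points on both sides of `s`, it would meet the
wall of `s`. -/
lemma IsCATZero.wall_subset_halfSpace (hX : IsCATZero X) {s t : X ≃ᵢ X} {x₀ : X}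
    (hdisj : Disjoint (wall s) (wall t)) {z : X} (hz : z ∈ wall t)
    (hz' : z ∈ halfSpace x₀ s) : wall t ⊆ halfSpace x₀ s := by
  intro w hw
  by_contra hcon
  rw [halfSpace_eq hz'] at hcon
  have hsep : Separates s z w :=
    ⟨halfSpace_subset _ _ hz', disjoint_right.1 hdisj hw, hcon⟩
  obtain ⟨c, hc⟩ := hX.1 z w
  obtain ⟨a, ha, hca⟩ := hsep.exists_mem_wall hc
  exact disjoint_left.1 hdisj hca (hX.convex_wall t z hz w hw c hc a ha)

namespace IsFundamentalChamber

variable {x₀ : X} {C : Set X} {S : Set (X ≃ᵢ X)}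

/-- Every element of `W` attains its minimal displacement. -/
lemma exists_forall_dist_le (hX : IsCATZero X) (h : IsFundamentalChamber W x₀ C S) {g : X ≃ᵢ X}
    (hg : g ∈ W) : ∃ x, ∀ y, dist x (g x) ≤ dist y (g y) := by
  have := h.properSpace hX
  obtain ⟨D, hD, hdense⟩ := h.exists_dist_orbit_le hX
  have hmin : ∀ γ : X ≃ᵢ X, ∃ y ∈ Metric.closedBall x₀ D, ∀ z ∈ Metric.closedBall x₀ D,
      dist y (γ y) ≤ dist z (γ z) := fun γ =>
    (isCompact_closedBall x₀ D).exists_isMinOn ⟨x₀, Metric.mem_closedBall_self hD⟩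
      (continuous_id.dist γ.continuous).continuousOn
  choose m hmK hm using hmin
  set N := dist x₀ (g x₀) with hN
  -- Up to conjugation, a point displaced by at most `N` may be taken within `D` of `x₀`, and then
  -- the conjugate of `g` moves `x₀` by at most `2 * D + N`: finitely many candidates, each
  -- minimized on a compact ball.
  have hfin : {k | ∃ w ∈ W, k = w⁻¹ * g * w ∧ dist (k x₀) x₀ ≤ 2 * D + N}.Finite := by
    refine (h.proper.finite_setOf_dist_le x₀ x₀ (2 * D + N)).subset ?_
    rintro _ ⟨w, hw, rfl, hd⟩
    exact ⟨W.mul_mem (W.mul_mem (W.inv_mem hw) hg) hw, hd⟩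
  have hgF : g ∈ {k | ∃ w ∈ W, k = w⁻¹ * g * w ∧ dist (k x₀) x₀ ≤ 2 * D + N} :=
    ⟨1, W.one_mem, by group, by rw [dist_comm, ← hN]; linarith⟩
  obtain ⟨γ, ⟨w, hw, hγ, -⟩, hγmin⟩ :=
    hfin.exists_minimalFor (fun k => dist (m k) (k (m k))) _ ⟨g, hgF⟩
  have hmin : ∀ k, (∃ w ∈ W, k = w⁻¹ * g * w ∧ dist (k x₀) x₀ ≤ 2 * D + N) →
      dist (m γ) (γ (m γ)) ≤ dist (m k) (k (m k)) := fun k hk =>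
    (le_total _ _).elim id fun hle => hγmin hk hle
  have hconj : ∀ (u : X ≃ᵢ X) y, dist y ((u⁻¹ * g * u : X ≃ᵢ X) y) = dist (u y) (g (u y)) :=
    fun u y => by
      rw [← u.dist_eq, IsometryEquiv.mul_apply, IsometryEquiv.mul_apply,
        IsometryEquiv.apply_inv_self]
  refine ⟨w (m γ), fun y => ?_⟩
  rw [← hconj, ← hγ]
  by_cases hy : dist y (g y) ≤ N
  · obtain ⟨u, hu, hd⟩ := hdense y
    have e1 : dist (u⁻¹ y) x₀ ≤ D := by
      rw [← u.dist_eq, IsometryEquiv.apply_inv_self, dist_comm]; exact hd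
    have e2 := hconj u (u⁻¹ y)
    rw [IsometryEquiv.apply_inv_self] at e2
    have e3 := dist_triangle4 ((u⁻¹ * g * u : X ≃ᵢ X) x₀) ((u⁻¹ * g * u : X ≃ᵢ X) (u⁻¹ y))
      (u⁻¹ y) x₀
    rw [(u⁻¹ * g * u).dist_eq, dist_comm x₀, dist_comm ((u⁻¹ * g * u) (u⁻¹ y)), e2] at e3
    rw [← e2]
    exact (hmin _ ⟨u, hu, rfl, by linarith⟩).trans (hm _ _ e1)
  · exact ((hmin g hgF).trans (hm g x₀ (Metric.mem_closedBall_self hD))).trans (not_le.1 hy).le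

/-- If the walls of `s, t ∈ S` are disjoint, then so are the closed half-spaces opposite to the
chamber. -/
lemma mem_halfSpace_or (hX : IsCATZero X) (h : IsFundamentalChamber W x₀ C S) {s t : X ≃ᵢ X}
    (hs : s ∈ S) (ht : t ∈ S) (hst : s ≠ t) (hdisj : Disjoint (wall s) (wall t)) (y : X) :
    y ∈ halfSpace x₀ s ∨ y ∈ halfSpace x₀ t := by
  by_contra! hcon
  obtain ⟨a, ha, has, -⟩ := h.exists_face hX hs
  obtain ⟨b, hb, hbs, -⟩ := h.exists_face hX ht
  have hsub1 := hX.wall_subset_halfSpace hdisj hb (hbs s hs hst)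
  have hsub2 := hX.wall_subset_halfSpace hdisj.symm ha (has t ht hst.symm)
  have hys : y ∉ wall s := fun hy => hcon.2 (hsub2 hy)
  have hyt : y ∉ wall t := fun hy => hcon.1 (hsub1 hy)
  -- On the way to `a` the geodesic from `y` meets the wall of `s` before that of `t`; the crossing
  -- `c i` of `t` then lies between two points of the convex wall of `s`.
  have hsep1 : Separates t y a := by
    refine Separates.symm ⟨halfSpace_subset _ _ (hsub2 ha), hyt, ?_⟩
    rw [← halfSpace_eq (hsub2 ha)]; exact hcon.2
  obtain ⟨c, hc⟩ := hX.1 y a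
  obtain ⟨i, hi, hci⟩ := hsep1.exists_mem_wall hc
  have hcis := hsub1 hci
  have hsep2 : Separates s y (c i) := by
    refine Separates.symm ⟨halfSpace_subset _ _ hcis, hys, ?_⟩
    rw [← halfSpace_eq hcis]; exact hcon.1
  obtain ⟨j, hj, hcj⟩ := hsep2.exists_mem_wall (hc.initial hi)
  rw [hc.dist_left hi] at hj
  have hj' : j ∈ Icc 0 (dist y a) := ⟨hj.1, hj.2.trans hi.2⟩
  obtain ⟨d, hd⟩ := hX.1 (c j) a
  have e1 : dist (c j) (c i) = i - j := by
    rw [hc.2.2 j hj' i hi, abs_sub_comm, abs_of_nonneg (by linarith [hj.2])]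
  have e2 := hX.eq_of_dist_add hd (z := c i) (by
    rw [e1, hc.dist_right hi, hc.dist_right hj']; ring)
  have := hX.convex_wall s _ hcj _ ha d hd (dist (c j) (c i)) ⟨dist_nonneg, by
    rw [e1, hc.dist_right hj']; linarith [hi.2]⟩
  rw [e2] at this
  exact halfSpace_subset _ _ hcis this

/-- A geodesic that crosses the disjoint walls of `s` and `t` and no other wall of `S` passes
through the chamber. -/
lemma exists_mem_of_isGeodesic (hX : IsCATZero X) (h : IsFundamentalChamber W x₀ C S)
    {s t : X ≃ᵢ X} (hcov : ∀ y, y ∈ halfSpace x₀ s ∨ y ∈ halfSpace x₀ t) {p q : X}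
    (hp : p ∉ halfSpace x₀ s) (hq : q ∉ halfSpace x₀ t)
    (hpq : ∀ r ∈ S, r ≠ s → r ≠ t → p ∈ halfSpace x₀ r ∧ q ∈ halfSpace x₀ r) {c : ℝ → X}
    (hc : IsGeodesic c p q) : ∃ i ∈ Icc 0 (dist p q), c i ∈ C := by
  -- A connected set covered by two open half-spaces and meeting each of them meets their
  -- intersection.
  obtain ⟨_, ⟨i, hi, rfl⟩, his, hit⟩ := (isPreconnected_Icc.image c hc.continuousOn) _ _
    (hX.isOpen_halfSpace x₀ s) (hX.isOpen_halfSpace x₀ t) (fun y _ => hcov y)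
    ⟨q, ⟨_, ⟨dist_nonneg, le_rfl⟩, hc.2.1⟩, (hcov q).resolve_right hq⟩
    ⟨p, ⟨0, ⟨le_rfl, dist_nonneg⟩, hc.1⟩, (hcov p).resolve_left hp⟩
  refine ⟨i, hi, h.mem_iff.2 fun r hr => ?_⟩
  by_cases hrs : r = s
  · rwa [hrs]
  by_cases hrt : r = t
  · rwa [hrt]
  have hrR := h.minimal.1 hr
  exact hrR.2.convex_halfSpace (h.base_notMem_wall r hrR) p (hpq r hr hrs hrt).1 q
    (hpq r hr hrs hrt).2 c hc i hi

/-- Ping-pong: `s` maps its positive side to its negative side, which lies on the positive side of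
`t`, and symmetrically for `t`. The exponent is `n + 1` because the identity separates nothing. -/
lemma separates_pow (h : IsFundamentalChamber W x₀ C S) {s t : X ≃ᵢ X}
    (hs : s ∈ S) (ht : t ∈ S) (hcov : ∀ y, y ∈ halfSpace x₀ s ∨ y ∈ halfSpace x₀ t) (n : ℕ) :
    Separates t x₀ (((t * s) ^ (n + 1)) x₀) := by
  have hsR := h.minimal.1 hs
  have htR := h.minimal.1 ht
  have key : ∀ g ∈ W, g x₀ ∈ halfSpace x₀ s → Separates t x₀ (t (s (g x₀))) := by
    intro g hg hgs
    have hsg : (s * g : X ≃ᵢ X) ∈ W := W.mul_mem hsR.1 hg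
    have h1 : s (g x₀) ∉ halfSpace x₀ s := fun hcon =>
      (hsR.2.apply_mem_halfSpace_iff (h.base_notMem_wall s hsR) (h.notMem_wall hg s hsR)).1 hcon hgs
    have hw : s (g x₀) ∉ wall t := h.notMem_wall hsg t htR
    rw [htR.2.separates_apply_iff (h.base_notMem_wall t htR) hw,
      not_separates_iff (h.base_notMem_wall t htR) hw]
    exact (hcov _).resolve_left h1
  induction n with
  | zero =>
    have := key 1 W.one_mem (mem_halfSpace_self (h.base_notMem_wall s hsR))
    simpa [IsometryEquiv.mul_apply] using this
  | succ n ih =>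
    rw [pow_succ', IsometryEquiv.mul_apply, IsometryEquiv.mul_apply]
    exact key _ (W.pow_mem (W.mul_mem htR.1 hsR.1) _) ((hcov _).resolve_right ih.2.2)

/-- Coarsely, every element `w` can be chosen such that only the wall of `s₀` separates the chamber
from `w⁻¹ x₀`. -/
lemma exists_dist_le_separates (hX : IsCATZero X) (h : IsFundamentalChamber W x₀ C S)
    {T : Set (X ≃ᵢ X)} (hT : Maximal (IsSphericalSubset S) T) {s₀ : X ≃ᵢ X} (hs₀ : s₀ ∈ S)
    (hge : ∀ t ∈ T, orderOf (s₀ * t) = 0 ∨ 3 ≤ orderOf (s₀ * t)) {t₀ : X ≃ᵢ X} (ht₀ : t₀ ∈ T)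
    (hcov : ∀ y, y ∈ halfSpace x₀ s₀ ∨ y ∈ halfSpace x₀ t₀) :
    ∃ B : ℝ, ∀ g ∈ W, ∃ w ∈ W, dist (w x₀) (g x₀) ≤ B ∧ w⁻¹ x₀ ∉ halfSpace x₀ s₀ ∧
      ∀ s ∈ S, s ≠ s₀ → w⁻¹ x₀ ∈ halfSpace x₀ s := by
  have hTS := hT.prop.1
  have hTR : T ⊆ reflectionsIn W := hTS.trans h.minimal.1
  have hTW : Subgroup.closure T ≤ W := (Subgroup.closure_le W).2 fun _ hr => (hTR hr).1
  have hs₀R := h.minimal.1 hs₀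
  obtain ⟨B, hB⟩ := (hT.prop.2.image fun u : X ≃ᵢ X => dist (s₀ x₀) (u x₀)).bddAbove
  have hs₀T : s₀ ∉ T := fun hmem => by
    have := hge s₀ hmem
    rw [hs₀R.2.mul_self, orderOf_one] at this
    omega
  refine ⟨B, fun g hg => ?_⟩
  obtain ⟨u, hu, hdesc⟩ := exists_closure_forall_separates hX hTR hT.prop.2
    h.base_notMem_wall (h.notMem_wall (W.inv_mem hg))
  set v : X ≃ᵢ X := u * g⁻¹ with hv
  have hvW : v ∈ W := W.mul_mem (hTW hu) (W.inv_mem hg)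
  replace hdesc : ∀ s ∈ T, Separates s x₀ (v x₀) := hdesc
  -- Adjoining a descent to `T` keeps it spherical, so maximality of `T` applies.
  have hmem : ∀ s ∈ S, Separates s x₀ (v x₀) → s ∈ T := fun s hs hsep => by
    refine hT.le_of_ge (y := insert s T) ⟨insert_subset hs hTS, ?_⟩ (subset_insert s T)
      (mem_insert s T)
    refine h.finite_closure_of_separates hX (insert_subset hs hTS) hvW ?_
    rintro t (rfl | ht)
    exacts [hsep, hdesc t ht]
  have hvs₀ : v x₀ ∉ wall s₀ := h.notMem_wall hvW s₀ hs₀R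
  have hsep₀ : Separates s₀ x₀ ((s₀ * v) x₀) :=
    (hs₀R.2.separates_apply_iff (h.base_notMem_wall s₀ hs₀R) hvs₀).2 fun hcon =>
      hs₀T (hmem s₀ hs₀ hcon)
  have hvW' : s₀ * v ∈ W := W.mul_mem hs₀R.1 hvW
  have hcancel : s₀ ((s₀ * v) x₀) = v x₀ := hs₀R.2.apply_apply _
  refine ⟨(s₀ * v)⁻¹, W.inv_mem hvW', ?_, ?_, fun s hs hne => ?_⟩
  · have : dist ((s₀ * v)⁻¹ x₀) (g x₀) = dist (s₀ x₀) (u x₀) := by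
      rw [← (s₀ * v).dist_eq, IsometryEquiv.apply_inv_self, ← s₀.dist_eq, hv]
      simp only [IsometryEquiv.mul_apply, hs₀R.2.apply_apply, IsometryEquiv.inv_apply_self]
    rw [this]
    exact hB (mem_image_of_mem _ hu)
  · rw [inv_inv]; exact hsep₀.2.2
  · rw [inv_inv]
    have hsR := h.minimal.1 hs
    rw [← not_separates_iff (h.base_notMem_wall s hsR) (h.notMem_wall hvW' s hsR)]
    intro hsep
    have h1 := h.separates_apply_of_separates hX hs hs₀ hne hvW' hsep hsep₀
    rw [hcancel] at h1
    have hsT := hmem s hs h1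
    by_cases hst : s = t₀
    · subst hst
      exact (hcov _).elim hsep₀.2.2 hsep.2.2
    · have h2 := h.separates_apply_of_separates hX (hTS ht₀) hs (Ne.symm hst) hvW
        (hdesc t₀ ht₀) h1
      have hsq : (s₀ * s) ^ 2 ≠ 1 := fun hcon => by
        have h3 := orderOf_dvd_of_pow_eq_one hcon
        have h4 := Nat.le_of_dvd two_pos h3
        rcases hge s hsT with h5 | h5
        · rw [h5] at h3; omega
        · omega
      -- This makes `s₀` a descent of `s v`, where `t₀` already is one, against `hcov`.
      have h3 := h.separates_apply_apply_of_separates hX hs₀ hs hne.symm hsq hvW' hsep₀ hsep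
      rw [hcancel] at h3
      exact (hcov _).elim h3.2.2 h2.2.2

/-- If only the wall of `s` separates the chamber from `w⁻¹ x₀`, then rays from `x₀` to the
translate by `w` of the limit point of `t s` pass close to `w x₀`. -/
lemma exists_dist_ray_le (hX : IsCATZero X) (h : IsFundamentalChamber W x₀ C S)
    {s t : X ≃ᵢ X} (hs : s ∈ S) (ht : t ∈ S)
    (hcov : ∀ y, y ∈ halfSpace x₀ s ∨ y ∈ halfSpace x₀ t) {D : ℝ} (hD : ∀ y ∈ C, dist x₀ y ≤ D)
    {c : GeodesicRay X} {L : ℝ≥0} (hL : 0 < L) {x : X}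
    (hc : ∀ n : ℕ, c.toFun (n * L) = ((t * s) ^ n) x) {w : X ≃ᵢ X}
    (hws : w⁻¹ x₀ ∉ halfSpace x₀ s) (hw' : ∀ r ∈ S, r ≠ s → w⁻¹ x₀ ∈ halfSpace x₀ r)
    {τ : GeodesicRay X} (hτ : τ.toFun 0 = x₀) (hτw : τ.endpoint = (c.map w).endpoint) :
    ∃ i, dist (τ.toFun i) (w x₀) ≤ D + 1 := by
  obtain ⟨K₀, hK₀⟩ := GeodesicRay.endpoint_eq_iff.1 hτw
  set K := dist x₀ x + K₀ with hKdef
  have hK : ∀ n : ℕ, dist (w (((t * s) ^ n) x₀)) (τ.toFun (n * L)) ≤ K := fun n => by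
    have h1 := dist_triangle (w (((t * s) ^ n) x₀)) (w (((t * s) ^ n) x)) (τ.toFun (n * L))
    have h2 : dist (τ.toFun (n * L)) (w (c.toFun (n * L))) ≤ K₀ := hK₀ _
    rw [hc, dist_comm] at h2
    rw [w.dist_eq, ((t * s) ^ n).dist_eq] at h1
    linarith
  have hK0 : 0 ≤ K := dist_nonneg.trans (hK 0)
  set ρ := dist x₀ (w x₀) + D with hρ
  have hD0 : 0 ≤ D := dist_nonneg.trans (hD x₀ h.base)
  have hρ0 : 0 ≤ ρ := by positivity
  -- Chosen so that `n * L - K` exceeds both `ρ`, a bound for the time `i` below, and `2 * K * ρ`,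
  -- making the fellow-travelling error at most 1.
  obtain ⟨n, hn⟩ := exists_nat_gt ((K + ρ + 2 * K * ρ + 1) / (L : ℝ))
  have hL' : (0 : ℝ) < L := hL
  rw [div_lt_iff₀ hL'] at hn
  have hKρ : 0 ≤ 2 * K * ρ := by positivity
  obtain ⟨n, rfl⟩ : ∃ m, n = m + 1 := Nat.exists_eq_succ_of_ne_zero (by
    rintro rfl
    simp only [Nat.cast_zero, zero_mul] at hn
    linarith)
  obtain ⟨γ, hγ⟩ := hX.1 x₀ (w (((t * s) ^ (n + 1)) x₀))
  have hγ' := hγ.map w⁻¹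
  rw [IsometryEquiv.inv_apply_self] at hγ'
  obtain ⟨i, hi, hiC⟩ := h.exists_mem_of_isGeodesic hX hcov hws (h.separates_pow hs ht hcov n).2.2
    (fun r hr hrs hrt => ⟨hw' r hr hrs, by
      have hrR := h.minimal.1 hr
      have hmem : (t * s) ^ (n + 1) ∈ Subgroup.closure {s, t} :=
        pow_mem (mul_mem (Subgroup.subset_closure (by simp)) (Subgroup.subset_closure (by simp))) _
      have hsub : ({s, t} : Set (X ≃ᵢ X)) ⊆ S := pair_subset hs ht
      rw [← not_separates_iff (h.base_notMem_wall r hrR)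
        (h.notMem_wall (h.closure_le (Subgroup.closure_mono hsub hmem)) r hrR)]
      exact h.not_separates_of_mem_closure hX hsub hmem hr (by simp [hrs, hrt])⟩) hγ'
  rw [← w.dist_eq, IsometryEquiv.apply_inv_self] at hi
  have h1 : dist (w x₀) (γ i) ≤ D := by
    have := hD _ hiC
    rwa [← w.dist_eq, IsometryEquiv.apply_inv_self] at this
  have hiρ : i ≤ ρ := by
    have := dist_triangle x₀ (w x₀) (γ i)
    rw [hγ.dist_left hi] at this
    linarith
  lift i to ℝ≥0 using hi.1
  rw [← hτ] at hγ
  have hμ : ((((n + 1 : ℕ) : ℝ≥0) * L : ℝ≥0) : ℝ) = ((n + 1 : ℕ) : ℝ) * L := by push_cast; rfl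
  have h2 := GeodesicRay.dist_geodesic_le hX hγ (r := i) (m := ((n + 1 : ℕ) : ℝ≥0) * L) (K := K)
    (by rw [hτ]; exact hK (n + 1)) (by rw [hμ]; linarith) (by rw [hμ]; linarith)
  rw [hμ] at h2
  have h3 : (i : ℝ) / (((n + 1 : ℕ) : ℝ) * L - K) * (2 * K) ≤ 1 := by
    rw [div_mul_eq_mul_div, div_le_one (by linarith)]
    have : (i : ℝ) * (2 * K) ≤ ρ * (2 * K) := mul_le_mul_of_nonneg_right hiρ (by positivity)
    linarith
  refine ⟨i, ?_⟩
  have h4 := dist_triangle (τ.toFun i) (γ i) (w x₀)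
  rw [dist_comm _ (γ i), dist_comm (γ i) (w x₀)] at h4
  linarith

end IsFundamentalChamber

end Dynamics

/-! ### Density of the orbit and of the limit points -/

theorem mainTheorem7 {X : Type*} [MetricSpace X] (hX : IsCATZero X)
    (W : Subgroup (X ≃ᵢ X)) (hW : IsCocompactDiscreteReflectionGroup W)
    (C : Set X) (hC : IsChamber W C) (x₀ : X) (hx₀ : x₀ ∈ C)
    (S : Set (X ≃ᵢ X)) (hS : IsMinimalDefiningSet W x₀ C S)
    (T : Set (X ≃ᵢ X)) (hT : Maximal (IsSphericalSubset S) T)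
    (s₀ : X ≃ᵢ X) (hs₀ : s₀ ∈ S)
    (hge : ∀ t ∈ T, orderOf (s₀ * t) = 0 ∨ 3 ≤ orderOf (s₀ * t))
    (hinf : ∃ t₀ ∈ T, orderOf (s₀ * t₀) = 0) :
    (∃ α : VisualBoundary X, ∀ b : X,
      closure[boundaryTopology b] {ξ | ∃ w ∈ W, ξ = VisualBoundary.map w α} = univ) ∧
    (∀ b : X,
      closure[boundaryTopology b]
        {ξ | ∃ w ∈ W, orderOf w = 0 ∧ IsInfinitePower w ξ} = univ) := by
  have h := IsFundamentalChamber.of_isCocompact hX hW hC hx₀ hS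
  have := h.properSpace hX
  obtain ⟨t₀, ht₀, hord⟩ := hinf
  have ht₀S := hT.prop.1 ht₀
  have hsR := hS.1 hs₀
  have htR := hS.1 ht₀S
  have hne : s₀ ≠ t₀ := by
    rintro rfl
    rw [hsR.2.mul_self, orderOf_one] at hord
    exact one_ne_zero hord
  have hdisj : Disjoint (wall s₀) (wall t₀) := by
    rw [disjoint_left]
    intro z hz hz'
    -- A common point of the walls would be fixed by the infinite-order element `s₀ * t₀`.
    refine h.proper.apply_ne_of_orderOf_eq_zero (W.mul_mem hsR.1 htR.1) hord z ?_
    have e1 : s₀ z = z := hz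
    have e2 : t₀ z = z := hz'
    rw [IsometryEquiv.mul_apply, e2, e1]
  have hcov := h.mem_halfSpace_or hX hs₀ ht₀S hne hdisj
  have hgW : t₀ * s₀ ∈ W := W.mul_mem htR.1 hsR.1
  have hgord : orderOf (t₀ * s₀) = 0 := by
    rw [← orderOf_inv, mul_inv_rev, hsR.2.inv_eq, htR.2.inv_eq]; exact hord
  obtain ⟨x, hx⟩ := h.exists_forall_dist_le hX hgW
  obtain ⟨c, L, hL, hc⟩ := exists_ray_of_forall_dist_le hX hx
    (h.proper.apply_ne_of_orderOf_eq_zero hgW hgord x)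
  obtain ⟨D, -, hD⟩ := h.exists_dist_le
  obtain ⟨D', -, hD'⟩ := h.exists_dist_orbit_le hX
  obtain ⟨B, hB⟩ := h.exists_dist_le_separates hX hT hs₀ hge ht₀ hcov
  have hdense : ∀ b : X, closure[boundaryTopology b]
      {ξ | ∃ w ∈ W, ξ = VisualBoundary.map w c.endpoint} = univ := by
    intro b
    rw [eq_univ_iff_forall]
    intro ξ
    obtain ⟨e, rfl⟩ : ∃ e : GeodesicRay X, e.endpoint = ξ := Quotient.exists_rep ξ
    obtain ⟨e', he0, he, -⟩ := e.exists_asymptotic hX b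
    rw [← he]
    have key : ∀ n : ℕ, ∃ σ : GeodesicRay X, σ.toFun 0 = b ∧
        (∃ w ∈ W, σ.endpoint = VisualBoundary.map w c.endpoint) ∧
        ∃ i, dist (σ.toFun i) (e'.toFun n) ≤ 2 * dist b x₀ + (D + 1) + B + D' := by
      intro n
      obtain ⟨g, hg, hgd⟩ := hD' (e'.toFun n)
      obtain ⟨w, hw, hwd, hws, hws'⟩ := hB g hg
      obtain ⟨τ, hτ0, hτ, -⟩ := (c.map w).exists_asymptotic hX x₀
      obtain ⟨i, hi⟩ := h.exists_dist_ray_le hX hs₀ ht₀S hcov hD hL hc hws hws' hτ0 hτ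
      obtain ⟨σ, hσ0, hσ, hστ⟩ := τ.exists_asymptotic hX b
      refine ⟨σ, hσ0, ⟨w, hw, hσ.trans hτ⟩, i, ?_⟩
      have h1 := hστ i
      rw [hτ0] at h1
      have h2 := dist_triangle4 (σ.toFun i) (τ.toFun i) (w x₀) (e'.toFun n)
      have h3 := dist_triangle (w x₀) (g x₀) (e'.toFun n)
      linarith
    choose σ hσ0 hσ hσd using key
    exact mem_closure_boundaryTopology hX he0 hσ0 hσ
      (tendsto_ray_of_dist_le hX (fun n => (hσ0 n).trans he0.symm) hσd)
  refine ⟨⟨c.endpoint, hdense⟩, fun b => ?_⟩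
  rw [eq_univ_iff_forall]
  intro ξ
  -- Each point of the dense orbit is itself a limit of powers, namely of the conjugate of `t₀ * s₀`
  -- by `w`.
  refine @closure_mono _ (boundaryTopology b) _ _ ?_ ξ (hdense b ▸ mem_univ ξ)
  rintro _ ⟨w, hw, rfl⟩
  refine ⟨w * (t₀ * s₀) * w⁻¹, W.mul_mem (W.mul_mem hw hgW) (W.inv_mem hw), ?_, ?_⟩
  · rw [← hgord]
    exact orderOf_injective (MulAut.conj w).toMonoidHom (MulAut.conj w).injective (t₀ * s₀)
  · rw [VisualBoundary.map_endpoint]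
    refine isInfinitePower_of_dist_le hX (p := w x) (c := c.map w) hL (K := 0) fun n => ?_
    have : (c.map w).toFun (n * L) = w (((t₀ * s₀) ^ n) x) := by rw [← hc]; rfl
    rw [this, conj_pow, IsometryEquiv.mul_apply, IsometryEquiv.mul_apply,
      IsometryEquiv.inv_apply_self, dist_self]
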